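/- Let $\alpha\ge 1$, let $n$ be a natural number, and let $m_1,\dots,m_n>0$ be masses placed at distinct points $a_1,\dots,a_n\in\mathbb R^2$ which form a relative equilibrium with angular speed $1$, that is, $a_i=\sum_{j\ne i} m_j\,\dfrac{a_i-a_j}{\|a_i-a_j\|^{\alpha+1}}$ for every $i$. Let $$V(x)=\tfrac12\|x\|^2+\sum_{j=1}^n m_j\,\phi_\alpha(\|x-a_j\|),\qquad x\in U:=\mathbb R^2\setminus\{a_1,\dots,a_n\},$$ be the planar potential of the satellite, where $\phi_\alpha'(r)=-1/r^{\alpha}$ for $r>0$, namely $\phi_1(r)=-\log r$ and $\phi_\alpha(r)=r^{1-\alpha}/(\alpha-1)$ for $\alpha>1$. Then: 1. $V$ has no local maximum in $U$. 2. $V$ attains a global minimum on $U$. 3. If $V$ is a Morse function on $U$ (that is, $V$ is smooth on $U$ and the Hessian of $V$ is nondegenerate at each of its critical points in $U$), then $V$ has only finitely many local minimum points and saddle points in $U$ (a saddle point is a critical point that is neither a local minimum nor a local maximum), their numbers satisfy $$\#\{\text{saddle points}\}=n-1+\#\{\text{local minimum points}\},$$ and there are at least $n$ saddle points. -/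

import Mathlib

open scoped ContDiff

noncomputable section

namespace Satellite

/-- The Euclidean plane. -/
abbrev Plane : Type := EuclideanSpace ℝ (Fin 2)

/-- The attraction potential `φ_α`: the primitive of `r ↦ -1 / r ^ α` on `(0, ∞)`,
that is `-log r` if `α = 1` and `r ^ (1 - α) / (α - 1)` otherwise. -/
def phi (α r : ℝ) : ℝ :=
  if α = 1 then -Real.log r else r ^ (1 - α) / (α - 1)

/-- The defining property `φ_α' (r) = -1 / r ^ α` of the attraction potential. -/
theorem hasDerivAt_phi (α : ℝ) {r : ℝ} (hr : 0 < r) :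
    HasDerivAt (phi α) (-1 / r ^ α) r := by
  by_cases h : α = 1
  · subst h
    have h1 : phi 1 = fun x => -Real.log x := by
      funext x
      simp [phi]
    rw [h1]
    have h2 : HasDerivAt (fun x => -Real.log x) (-r⁻¹) r := (Real.hasDerivAt_log hr.ne').neg
    have h3 : -1 / r ^ (1 : ℝ) = -r⁻¹ := by
      rw [Real.rpow_one, neg_div, one_div]
    rw [h3]
    exact h2
  · have h1 : phi α = fun x => x ^ (1 - α) / (α - 1) := by
      funext x
      simp [phi, h]
    have h2 : α - 1 ≠ 0 := sub_ne_zero.mpr h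
    rw [h1]
    have h3 := (Real.hasDerivAt_rpow_const (p := 1 - α) (Or.inl hr.ne')).div_const (α - 1)
    have h4 : (1 - α) * r ^ (1 - α - 1) / (α - 1) = -1 / r ^ α := by
      have h5 : 1 - α - 1 = -α := by ring
      rw [h5, Real.rpow_neg hr.le]
      have h6 : r ^ α ≠ 0 := (Real.rpow_pos_of_pos hr α).ne'
      field_simp
      ring
    rwa [h4] at h3

/-- The planar potential of the satellite for primaries at `a j` with masses `m j`:
`V(x) = ‖x‖² / 2 + ∑ j, m j * φ_α (‖x - a j‖)`. It is only meaningful on `freeRegion a`. -/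
def potential (α : ℝ) {n : ℕ} (m : Fin n → ℝ) (a : Fin n → Plane) (x : Plane) : ℝ :=
  ‖x‖ ^ 2 / 2 + ∑ j, m j * phi α ‖x - a j‖

/-- The positions of the satellite without collision: the plane minus the primaries. -/
def freeRegion {n : ℕ} (a : Fin n → Plane) : Set Plane :=
  (Set.range a)ᶜ

/-- The primaries form a relative equilibrium with angular speed `1`. -/
def IsRelativeEquilibrium (α : ℝ) {n : ℕ} (m : Fin n → ℝ) (a : Fin n → Plane) : Prop :=
  ∀ i, a i = ∑ j ∈ Finset.univ.erase i, (m j / ‖a i - a j‖ ^ (α + 1)) • (a i - a j)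

/-- `x` is a critical point of `f` (differentiability at `x` included). -/
def IsCriticalPoint (f : Plane → ℝ) (x : Plane) : Prop :=
  HasFDerivAt f (0 : Plane →L[ℝ] ℝ) x

/-- The Hessian of `f` at `x`, as a bilinear form, is nondegenerate. -/
def HasNondegenerateHessian (f : Plane → ℝ) (x : Plane) : Prop :=
  ∀ u : Plane, (∀ v : Plane, fderiv ℝ (fderiv ℝ f) x u v = 0) → u = 0

/-- `f` is a Morse function on the open set `U`: it is smooth on `U` and all its critical points
in `U` are nondegenerate. -/
def IsMorseOn (f : Plane → ℝ) (U : Set Plane) : Prop :=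
  ContDiffOn ℝ ∞ f U ∧ ∀ x ∈ U, IsCriticalPoint f x → HasNondegenerateHessian f x

/-- The (local) minimum points of `f` in the open set `U`. -/
def minimumPoints (f : Plane → ℝ) (U : Set Plane) : Set Plane :=
  {x | x ∈ U ∧ IsLocalMin f x}

/-- The saddle points of `f` in the open set `U`: the critical points of `f` in `U` that are
neither local minima nor local maxima. -/
def saddlePoints (f : Plane → ℝ) (U : Set Plane) : Set Plane :=
  {x | x ∈ U ∧ IsCriticalPoint f x ∧ ¬ IsLocalMin f x ∧ ¬ IsLocalMax f x}

end Satellite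

end

namespace Satellite
open Set Filter Topology MeasureTheory Bornology
open scoped RealInnerProductSpace

/-! On the free region `U` the gradient of the potential is the field `force`, which is `x` minus
the attractions of the primaries. The trace of its derivative is `2 + (α - 1) ∑ m_j ‖x - a_j‖ ^ (-(α
+ 1))`, which is positive. So no critical point is a maximum, and a nondegenerate one is a minimum
or a saddle according to the sign of the Hessian determinant. Hence minima minus saddles is the
degree of `force` at the value `0`.

The norm of `force` tends to infinity at infinity and at every primary, so the degree is the same at
a far value `T • stdVec 0` (`sum_sign_det_eq`). There the fibre is explicit (`exists_force_fiber`):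
one point far away, where `force` is close to the identity and the determinant is positive, and one
point near each primary, where a single singular term dominates and the determinant is negative. The
degree is therefore `1 - n`.

Invariance of the degree is proved by integration. For `w` of compact support the integral of
`∂₀w(F) det DF` vanishes by Stokes; if `∂₀w` is a bump at `0` minus its translate at the other
value, the change of variables turns this into equality of the two signed counts.

The potential blows up at the ends of `U`, so it has a global minimum; the count then gives at least
`n` saddles. -/

/-- The standard basis vectors of the plane. -/
noncomputable abbrev stdVec (i : Fin 2) : Plane := EuclideanSpace.single i 1

/-- The coordinate functions of the plane. -/
noncomputable abbrev coord (i : Fin 2) : Plane →L[ℝ] ℝ := EuclideanSpace.proj i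

theorem eq_smul_stdVec_add (v : Plane) : v = v 0 • stdVec 0 + v 1 • stdVec 1 := by
  ext i
  fin_cases i <;> simp

theorem det_eq_stdVec (A : Plane →L[ℝ] Plane) :
    A.det = A (stdVec 0) 0 * A (stdVec 1) 1 - A (stdVec 1) 0 * A (stdVec 0) 1 := by
  have h := LinearMap.det_toMatrix (EuclideanSpace.basisFun (Fin 2) ℝ).toBasis (A : Plane →ₗ[ℝ] Plane)
  rw [ContinuousLinearMap.det, ← h, Matrix.det_fin_two]
  simp [LinearMap.toMatrix_apply]

/-! ### Invariance of the degree by integration -/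

theorem integral_fderiv_apply_eq_zero {f : Plane → ℝ} (hf : ContDiff ℝ 1 f)
    (hc : HasCompactSupport f) (v : Plane) : ∫ x, fderiv ℝ f x v = 0 := by
  have h1 : Continuous fun x => fderiv ℝ f x v := (hf.continuous_fderiv one_ne_zero).clm_apply continuous_const
  have h2 : Integrable (fun x => fderiv ℝ f x v) :=
    h1.integrable_of_hasCompactSupport (hc.fderiv_apply ℝ v)
  have h3 : Integrable f := hf.continuous.integrable_of_hasCompactSupport hc
  have := integral_mul_fderiv_eq_neg_fderiv_mul_of_integrable (μ := volume) (f := fun _ : Plane => (1 : ℝ))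
    (g := f) (v := v) (by simp) (by simpa using h2) (by simpa using h3)
    (fun _ _ => differentiableAt_const _) (fun _ _ => (hf.differentiable one_ne_zero).differentiableAt)
  simpa using this

/-- Extension by zero of a function vanishing off a compact subset of an open set. -/
theorem contDiff_indicator_of_eq_zero {U K : Set Plane} (hU : IsOpen U) (hK : IsCompact K)
    (hKU : K ⊆ U) {f : Plane → ℝ} (hf : ContDiffOn ℝ 1 f U) (h0 : ∀ x ∈ U \ K, f x = 0) :
    ContDiff ℝ 1 (U.indicator f) ∧ HasCompactSupport (U.indicator f) := by
  have hz : ∀ x, x ∉ K → U.indicator f x = 0 := by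
    intro x hx
    by_cases hxU : x ∈ U
    · rw [indicator_of_mem hxU, h0 x ⟨hxU, hx⟩]
    · exact indicator_of_notMem hxU f
  refine ⟨contDiff_iff_contDiffAt.2 fun x => ?_, HasCompactSupport.intro hK hz⟩
  by_cases hx : x ∈ K
  · refine (hf.contDiffAt (hU.mem_nhds (hKU hx))).congr_of_eventuallyEq ?_
    filter_upwards [hU.mem_nhds (hKU hx)] with y hy using indicator_of_mem hy f
  · refine (contDiffAt_const (c := (0 : ℝ))).congr_of_eventuallyEq ?_
    filter_upwards [hK.isClosed.isOpen_compl.mem_nhds hx] with y hy using hz y hy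

/-- `F` tends to infinity at the ends of `U`. -/
def IsProperOn (F : Plane → Plane) (U : Set Plane) : Prop :=
  ∀ R : ℝ, ∃ K, IsCompact K ∧ K ⊆ U ∧ ∀ x ∈ U \ K, R < ‖F x‖

/-- The term with the second derivative of `F` is symmetric in `u` and `v`, so it drops out of the
antisymmetric difference formed in the next theorem. -/
theorem fderiv_mul_jacobian_entry {F : Plane → Plane} {w : Plane → ℝ} {x : Plane}
    (hF : ContDiffAt ℝ 2 F x) (hw : DifferentiableAt ℝ w (F x)) (u v : Plane) (i : Fin 2) :
    fderiv ℝ (fun x => w (F x) * (fderiv ℝ F x u) i) x v =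
      fderiv ℝ w (F x) (fderiv ℝ F x v) * (fderiv ℝ F x u) i +
        w (F x) * (fderiv ℝ (fderiv ℝ F) x v u) i := by
  have h1 : HasFDerivAt F (fderiv ℝ F x) x := (hF.differentiableAt two_ne_zero).hasFDerivAt
  have h2 : HasFDerivAt (fderiv ℝ F) (fderiv ℝ (fderiv ℝ F) x) x :=
    ((hF.fderiv_right (m := 1) (by norm_num)).differentiableAt one_ne_zero).hasFDerivAt
  have h3 := hw.hasFDerivAt.comp x h1
  have h4 := h2.clm_apply (hasFDerivAt_const u x)
  have h5 := ((coord i).hasFDerivAt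
    (x := fderiv ℝ F x u)).comp x h4
  have h6 := (h3.mul h5).fderiv
  have h7 : fderiv ℝ (fun x => w (F x) * (fderiv ℝ F x u) i) x v =
    fderiv ℝ ((w ∘ F) * (⇑(coord i) ∘
      fun y => (fderiv ℝ F y) u)) x v := rfl
  rw [h7, h6]
  simp
  ring

/-- The integrand is the exterior derivative of the one-form `w(F) dF₁`. Properness makes `w ∘ F`
vanish off a compact subset of `U`, so the form extends by zero to the plane and each partial
derivative integrates to zero. -/
theorem integral_fderiv_comp_mul_det_eq_zero {U : Set Plane} (hU : IsOpen U) {F : Plane → Plane}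
    (hF : ContDiffOn ℝ 2 F U) (hP : IsProperOn F U) {w : Plane → ℝ} (hw : ContDiff ℝ 1 w)
    (hwc : HasCompactSupport w) :
    ∫ x in U, fderiv ℝ w (F x) (stdVec 0) * (fderiv ℝ F x).det = 0 := by
  obtain ⟨R, hR⟩ := hwc.isCompact.isBounded.exists_norm_le
  obtain ⟨K, hK, hKU, hKF⟩ := hP R
  have hw0 : ∀ x ∈ U \ K, w (F x) = 0 := fun x hx => by
    by_contra h
    exact (hR _ (subset_tsupport _ h)).not_gt (hKF x hx)
  have key : ∀ u : Plane, ContDiff ℝ 1 (U.indicator fun x => w (F x) * (fderiv ℝ F x u) 1) ∧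
      HasCompactSupport (U.indicator fun x => w (F x) * (fderiv ℝ F x u) 1) := by
    intro u
    refine contDiff_indicator_of_eq_zero hU hK hKU ?_ (fun x hx => by rw [hw0 x hx, zero_mul])
    have h1 : ContDiffOn ℝ 1 (fderiv ℝ F) U := hF.fderiv_of_isOpen hU (by norm_num)
    have h2 : ContDiffOn ℝ 1 (fun x => fderiv ℝ F x u) U := h1.clm_apply contDiffOn_const
    have h3 : ContDiffOn ℝ 1 (fun x => (fderiv ℝ F x u) 1) U :=
      (coord 1).contDiff.comp_contDiffOn h2
    exact (hw.comp_contDiffOn (hF.of_le (by norm_num))).mul h3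
  set f : Plane → Plane → ℝ := fun u => U.indicator fun x => w (F x) * (fderiv ℝ F x u) 1 with hf
  have hint : ∀ u v : Plane, Integrable fun x => fderiv ℝ (f u) x v := fun u v =>
    (((key u).1.continuous_fderiv one_ne_zero).clm_apply
      continuous_const).integrable_of_hasCompactSupport ((key u).2.fderiv_apply ℝ v)
  have hsum : ∫ x, (fderiv ℝ (f (stdVec 1)) x (stdVec 0) - fderiv ℝ (f (stdVec 0)) x (stdVec 1)) = 0 := by
    rw [integral_sub (hint _ _) (hint _ _), integral_fderiv_apply_eq_zero (key _).1 (key _).2,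
      integral_fderiv_apply_eq_zero (key _).1 (key _).2, sub_zero]
  rw [← integral_indicator hU.measurableSet, ← hsum]
  congr 1
  funext x
  by_cases hx : x ∈ U
  · have hFx : ContDiffAt ℝ 2 F x := hF.contDiffAt (hU.mem_nhds hx)
    have hloc : ∀ u, f u =ᶠ[𝓝 x] fun x => w (F x) * (fderiv ℝ F x u) 1 := fun u => by
      filter_upwards [hU.mem_nhds hx] with y hy using indicator_of_mem hy _
    have hdw : DifferentiableAt ℝ w (F x) := (hw.differentiable one_ne_zero).differentiableAt
    have hsymm : fderiv ℝ (fderiv ℝ F) x (stdVec 0) (stdVec 1) =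
        fderiv ℝ (fderiv ℝ F) x (stdVec 1) (stdVec 0) :=
      (hFx.isSymmSndFDerivAt (by simp)) _ _
    rw [indicator_of_mem hx, (hloc _).fderiv_eq, (hloc _).fderiv_eq,
      fderiv_mul_jacobian_entry hFx hdw, fderiv_mul_jacobian_entry hFx hdw, hsymm, det_eq_stdVec]
    have hlin : ∀ v : Plane, fderiv ℝ w (F x) v =
        v 0 * fderiv ℝ w (F x) (stdVec 0) + v 1 * fderiv ℝ w (F x) (stdVec 1) := fun v => by
      conv_lhs => rw [eq_smul_stdVec_add v]
      simp
    rw [hlin (fderiv ℝ F x (stdVec 0)), hlin (fderiv ℝ F x (stdVec 1))]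
    ring
  · have hxK : x ∉ K := fun h => hx (hKU h)
    have hloc : ∀ u, f u =ᶠ[𝓝 x] fun _ => 0 := fun u => by
      filter_upwards [hK.isClosed.isOpen_compl.mem_nhds hxK] with y hy
      by_cases hyU : y ∈ U
      · simp [hf, indicator_of_mem hyU, hw0 y ⟨hyU, hy⟩]
      · exact indicator_of_notMem hyU _
    rw [indicator_of_notMem hx, (hloc _).fderiv_eq, (hloc _).fderiv_eq]
    simp

theorem abs_det_mul_sign {c d : ℝ} (h : 0 < c * d) : |c| * (SignType.sign d : ℝ) = c := by
  rcases lt_trichotomy d 0 with hd | hd | hd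
  · rw [sign_neg hd, abs_of_neg (neg_of_mul_pos_left h hd.le)]; simp
  · simp [hd] at h
  · rw [sign_pos hd, abs_of_pos (pos_of_mul_pos_left h hd.le)]; simp

/-- A regular point has arbitrarily small neighbourhoods on which the map is injective, open at the
point, and has Jacobian determinant of constant sign. -/
theorem exists_isOpen_injOn_det {U N : Set Plane} (hU : IsOpen U) {F : Plane → Plane}
    (hF : ContDiffOn ℝ 2 F U) {x : Plane} (hx : x ∈ U) (hN : N ∈ 𝓝 x)
    (hdet : (fderiv ℝ F x).det ≠ 0) :
    ∃ W, IsOpen W ∧ x ∈ W ∧ W ⊆ U ∩ N ∧ InjOn F W ∧ F '' W ∈ 𝓝 (F x) ∧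
      ∀ z ∈ W, 0 < (fderiv ℝ F z).det * (fderiv ℝ F x).det := by
  have hFx : ContDiffAt ℝ 2 F x := hF.contDiffAt (hU.mem_nhds hx)
  have hs : HasStrictFDerivAt F ((fderiv ℝ F x).toContinuousLinearEquivOfDetNeZero hdet :
      Plane →L[ℝ] Plane) x := hFx.hasStrictFDerivAt two_ne_zero
  have hc : ContinuousAt (fun z => (fderiv ℝ F z).det * (fderiv ℝ F x).det) x :=
    ((ContinuousLinearMap.continuous_det.continuousAt).comp
      ((hFx.fderiv_right (m := 1) (by norm_num)).continuousAt)).mul continuousAt_const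
  have h1 : ∀ᶠ z in 𝓝 x, 0 < (fderiv ℝ F z).det * (fderiv ℝ F x).det :=
    hc.eventually (lt_mem_nhds (mul_self_pos.2 hdet))
  have h2 : (hs.toOpenPartialHomeomorph F).source ∈ 𝓝 x :=
    (hs.toOpenPartialHomeomorph F).open_source.mem_nhds hs.mem_toOpenPartialHomeomorph_source
  obtain ⟨W, hW, hWo, hxW⟩ := mem_nhds_iff.1 (inter_mem (inter_mem (hU.mem_nhds hx) hN)
    (inter_mem h1 h2))
  refine ⟨W, hWo, hxW, fun z hz => (hW hz).1, fun z hz z' hz' h => ?_, ?_, fun z hz => (hW hz).2.1⟩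
  · exact (hs.toOpenPartialHomeomorph F).injOn (hW hz).2.2 (hW hz').2.2 h
  · rw [← hs.map_nhds_eq_of_equiv]
    exact image_mem_map (hWo.mem_nhds hxW)

/-- Near each preimage of `y` the map is injective with Jacobian of fixed sign, and away from these
neighbourhoods `F` keeps a positive distance from `y`. A function concentrated near `y` therefore
pulls back to one signed copy of itself per preimage. -/
theorem exists_integral_comp_mul_det_eq {U : Set Plane} (hU : IsOpen U) {F : Plane → Plane}
    (hF : ContDiffOn ℝ 2 F U) (hP : IsProperOn F U) {y : Plane} {S : Finset Plane}
    (hS : ∀ x, x ∈ S ↔ x ∈ U ∧ F x = y) (hdet : ∀ x ∈ S, (fderiv ℝ F x).det ≠ 0) :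
    ∃ ε > 0, ∀ ρ : Plane → ℝ, Continuous ρ → (∀ z, ε ≤ ‖z - y‖ → ρ z = 0) →
      IntegrableOn (fun x => ρ (F x) * (fderiv ℝ F x).det) U ∧
      ∫ x in U, ρ (F x) * (fderiv ℝ F x).det =
        (∫ z, ρ z) * ∑ x ∈ S, (SignType.sign (fderiv ℝ F x).det : ℝ) := by
  obtain ⟨N, hN, hNd⟩ := S.finite_toSet.t2_separation
  have hW : ∀ x : S, ∃ W, IsOpen W ∧ (x : Plane) ∈ W ∧ W ⊆ U ∩ N x ∧ InjOn F W ∧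
      F '' W ∈ 𝓝 (F x) ∧ ∀ z ∈ W, 0 < (fderiv ℝ F z).det * (fderiv ℝ F x).det := fun x =>
    exists_isOpen_injOn_det hU hF ((hS x).1 x.2).1 ((hN x).2.mem_nhds (hN x).1) (hdet x x.2)
  choose W hWo hxW hWU hWi hWn hWd using hW
  -- Off `K` the values of `F` are at distance more than `1` from `y`; this is why `ε` is taken
  -- below `1`.
  obtain ⟨K, hK, hKU, hKF⟩ := hP (‖y‖ + 1)
  have hFc : ContinuousOn F U := hF.continuousOn
  have h1 : ∃ ε > 0, ∀ z ∈ K \ ⋃ x, W x, ε ≤ ‖F z - y‖ := by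
    have hc : IsCompact (K \ ⋃ x, W x) := hK.diff (isOpen_iUnion hWo)
    rcases (K \ ⋃ x, W x).eq_empty_or_nonempty with he | hne
    · exact ⟨1, one_pos, by simp [he]⟩
    · obtain ⟨z, hz, hmin⟩ := hc.exists_isMinOn hne
        (f := fun z => ‖F z - y‖) ((hFc.mono (sdiff_subset.trans hKU)).sub continuousOn_const).norm
      refine ⟨‖F z - y‖, norm_pos_iff.2 fun h => ?_, fun z' hz' => hmin hz'⟩
      have hzS : z ∈ S := (hS z).2 ⟨hKU hz.1, sub_eq_zero.1 h⟩
      exact hz.2 (mem_iUnion.2 ⟨⟨z, hzS⟩, hxW ⟨z, hzS⟩⟩)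
  obtain ⟨ε₁, hε₁, hε₁'⟩ := h1
  have h2 : ∀ᶠ ε in 𝓝[>] (0 : ℝ), ∀ x : S, Metric.ball y ε ⊆ F '' W x := by
    refine eventually_all.2 fun x => ?_
    have := hWn x
    rw [((hS x).1 x.2).2] at this
    obtain ⟨δ, hδ, hδ'⟩ := Metric.mem_nhds_iff.1 this
    filter_upwards [nhdsWithin_le_nhds (gt_mem_nhds hδ)] with ε hε using
      (Metric.ball_subset_ball hε.le).trans hδ'
  obtain ⟨ε, ⟨⟨hεW, hεε₁⟩, hε1⟩, hε⟩ := (((h2.and (nhdsWithin_le_nhds (gt_mem_nhds hε₁))).and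
    (nhdsWithin_le_nhds (gt_mem_nhds one_pos))).and self_mem_nhdsWithin).exists
  refine ⟨ε, hε, fun ρ hρ hρ0 => ?_⟩
  have hzero : ∀ z ∈ U \ ⋃ x, W x, ρ (F z) * (fderiv ℝ F z).det = 0 := by
    intro z hz
    rw [hρ0 (F z), zero_mul]
    by_cases hzK : z ∈ K
    · exact hεε₁.le.trans (hε₁' z ⟨hzK, hz.2⟩)
    · have h3 := hKF z ⟨hz.1, hzK⟩
      have h4 := norm_sub_norm_le (F z) y
      linarith
  have hzero' : ∀ z ∈ U \ K, ρ (F z) * (fderiv ℝ F z).det = 0 := by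
    intro z hz
    rw [hρ0 (F z), zero_mul]
    have h3 := hKF z hz
    have h4 := norm_sub_norm_le (F z) y
    linarith
  have hcont : ContinuousOn (fun x => ρ (F x) * (fderiv ℝ F x).det) U :=
    (hρ.comp_continuousOn hFc).mul (ContinuousLinearMap.continuous_det.comp_continuousOn
      (hF.continuousOn_fderiv_of_isOpen hU (by norm_num)))
  have hint : IntegrableOn (fun x => ρ (F x) * (fderiv ℝ F x).det) U :=
    ((hcont.mono hKU).integrableOn_compact hK).of_forall_sdiff_eq_zero hU.measurableSet hzero'
  refine ⟨hint, ?_⟩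
  have hdisj : Pairwise (Function.onFun Disjoint W) := fun x x' hxx' =>
    (hNd x.2 x'.2 (fun h => hxx' (Subtype.ext h))).mono
      ((hWU x).trans inter_subset_right) ((hWU x').trans inter_subset_right)
  have hWUU : ⋃ x, W x ⊆ U := iUnion_subset fun x => (hWU x).trans inter_subset_left
  have hlocal : ∀ x : S, ∫ z in W x, ρ (F z) * (fderiv ℝ F z).det =
      (∫ z, ρ z) * (SignType.sign (fderiv ℝ F x).det : ℝ) := by
    intro x
    have himg := integral_image_eq_integral_abs_det_fderiv_smul volume (hWo x).measurableSet
      (fun z hz => ((hF.contDiffAt (hU.mem_nhds ((hWU x) hz).1)).differentiableAt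
        two_ne_zero).hasFDerivAt.hasFDerivWithinAt) (hWi x) ρ
    have hfull : ∫ z in F '' W x, ρ z = ∫ z, ρ z := by
      refine setIntegral_eq_integral_of_forall_compl_eq_zero fun z hz => hρ0 z ?_
      by_contra h
      exact hz (hεW x (mem_ball_iff_norm.2 (not_le.1 h)))
    rw [← hfull, himg, ← integral_mul_const]
    refine setIntegral_congr_fun (hWo x).measurableSet fun z hz => ?_
    have := abs_det_mul_sign (hWd x z hz)
    simp only [smul_eq_mul]
    rw [mul_right_comm, this, mul_comm]
  rw [setIntegral_eq_of_subset_of_forall_sdiff_eq_zero hU.measurableSet hWUU hzero,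
    integral_iUnion_fintype (fun x => (hWo x).measurableSet) hdisj
      (fun x => hint.mono_set ((hWU x).trans inter_subset_left)), Finset.mul_sum,
    ← Finset.sum_coe_sort S]
  exact Finset.sum_congr rfl fun x _ => hlocal x

theorem fderiv_mul_coord_stdVec {X ψ : ℝ → ℝ} (hX : Differentiable ℝ X) (hψ : Differentiable ℝ ψ)
    (z : Plane) : fderiv ℝ (fun z : Plane => X (z 0) * ψ (z 1)) z (stdVec 0) =
      deriv X (z 0) * ψ (z 1) := by
  have h0 : HasFDerivAt (fun z : Plane => X (z 0)) _ z :=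
    (hX (z 0)).hasDerivAt.comp_hasFDerivAt z (coord 0).hasFDerivAt
  have h1 : HasFDerivAt (fun z : Plane => ψ (z 1)) _ z :=
    (hψ (z 1)).hasDerivAt.comp_hasFDerivAt z (coord 1).hasFDerivAt
  have h2 : fderiv ℝ (fun z : Plane => X (z 0) * ψ (z 1)) z = _ := (h0.mul h1).fderiv
  rw [h2]
  simp
  ring

theorem norm_le_abs_add_abs (z : Plane) : ‖z‖ ≤ |z 0| + |z 1| := by
  conv_lhs => rw [eq_smul_stdVec_add z]
  refine (norm_add_le _ _).trans ?_
  simp [norm_smul]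

/-- Invariance of the degree: two regular values of a map that is proper on `U` have the same
number of preimages, counted with the sign of the Jacobian determinant. -/
theorem sum_sign_det_eq {U : Set Plane} (hU : IsOpen U) {F : Plane → Plane}
    (hF : ContDiffOn ℝ 2 F U) (hP : IsProperOn F U) {T : ℝ} (hT : 0 < T) {S₀ S₁ : Finset Plane}
    (hS₀ : ∀ x, x ∈ S₀ ↔ x ∈ U ∧ F x = 0) (hdet₀ : ∀ x ∈ S₀, (fderiv ℝ F x).det ≠ 0)
    (hS₁ : ∀ x, x ∈ S₁ ↔ x ∈ U ∧ F x = T • stdVec 0)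
    (hdet₁ : ∀ x ∈ S₁, (fderiv ℝ F x).det ≠ 0) :
    ∑ x ∈ S₀, (SignType.sign (fderiv ℝ F x).det : ℝ) =
      ∑ x ∈ S₁, (SignType.sign (fderiv ℝ F x).det : ℝ) := by
  obtain ⟨ε₀, hε₀, H₀⟩ := exists_integral_comp_mul_det_eq hU hF hP hS₀ hdet₀
  obtain ⟨ε₁, hε₁, H₁⟩ := exists_integral_comp_mul_det_eq hU hF hP hS₁ hdet₁
  -- The bump `ρ` below lives in the square `|z 0|, |z 1| ≤ η`, hence in the ball of radius `2 * η`.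
  obtain ⟨η, hη, hη₀, hη₁⟩ : ∃ η > 0, 2 * η < ε₀ ∧ 2 * η < ε₁ :=
    ⟨min ε₀ ε₁ / 3, by positivity, by linarith [min_le_left ε₀ ε₁, lt_min hε₀ hε₁],
      by linarith [min_le_right ε₀ ε₁, lt_min hε₀ hε₁]⟩
  set X : ℝ → ℝ := fun s => Real.smoothTransition (s / η) with hXdef
  have hXs : ContDiff ℝ ∞ X := Real.smoothTransition.contDiff.comp (contDiff_id.div_const η)
  have hXd : Differentiable ℝ X := hXs.differentiable (by simp)
  have hX0 : ∀ s ≤ 0, X s = 0 := fun s hs =>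
    Real.smoothTransition.zero_of_nonpos (div_nonpos_of_nonpos_of_nonneg hs hη.le)
  have hX1 : ∀ s, η ≤ s → X s = 1 := fun s hs =>
    Real.smoothTransition.one_of_one_le ((one_le_div hη).2 hs)
  have hXm : Monotone X := fun s t hst =>
    Real.smoothTransition.monotone (div_le_div_of_nonneg_right hst hη.le)
  have hdX : Continuous (deriv X) := hXs.continuous_deriv (by simp)
  have hdX0 : ∀ s, η < |s| → deriv X s = 0 := by
    intro s hs
    rcases lt_abs.1 hs with h | h
    · have : X =ᶠ[𝓝 s] fun _ => 1 := by
        filter_upwards [lt_mem_nhds h] with t ht using hX1 t ht.le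
      rw [this.deriv_eq, deriv_const]
    · have : X =ᶠ[𝓝 s] fun _ => 0 := by
        filter_upwards [gt_mem_nhds (show s < 0 by linarith)] with t ht using hX0 t ht.le
      rw [this.deriv_eq, deriv_const]
  let b : ContDiffBump (0 : ℝ) := ⟨η / 2, η, by positivity, by linarith⟩
  have hb0 : ∀ s, η < |s| → b s = 0 := fun s hs => b.zero_of_le_dist (by simpa using hs.le)
  have hbs : ContDiff ℝ ∞ b := b.contDiff
  set ρ : Plane → ℝ := fun z => deriv X (z 0) * b (z 1) with hρdef
  have hρc : Continuous ρ := (hdX.comp (coord 0).continuous).mul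
    (b.continuous.comp (coord 1).continuous)
  have hρ0 : ∀ z : Plane, 2 * η < ‖z‖ → ρ z = 0 := by
    intro z hz
    have h1 := norm_le_abs_add_abs z
    by_cases h0 : η < |z 0|
    · simp [hρdef, hdX0 _ h0]
    · simp [hρdef, hb0 (z 1) (by linarith)]
  have hρcs : HasCompactSupport ρ := HasCompactSupport.intro (isCompact_closedBall 0 (2 * η))
    fun z hz => hρ0 z (by simpa using hz)
  have hρpos : 0 < ∫ z, ρ z := by
    obtain ⟨s, hs⟩ : ∃ s, deriv X s ≠ 0 := by
      by_contra! h
      have h1 := is_const_of_deriv_eq_zero hXd h 0 η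
      rw [hX0 0 le_rfl, hX1 η le_rfl] at h1
      exact zero_ne_one h1
    refine hρc.integral_pos_of_hasCompactSupport_nonneg_nonzero (x := !₂[s, 0]) hρcs
      (fun z => mul_nonneg hXm.deriv_nonneg b.nonneg) ?_
    have h1 : b 0 = 1 := b.one_of_mem_closedBall (by simp [b]; positivity)
    simp [hρdef, h1, hs]
  -- `X` is a smooth step, so `Y` has compact support, and differentiating it yields the bump at `0`
  -- minus its translate by `T`.
  set Y : ℝ → ℝ := fun s => X s - X (s - T) with hYdef
  have hYs : ContDiff ℝ ∞ Y := hXs.sub (hXs.comp (contDiff_id.sub contDiff_const))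
  have hYd : ∀ s, deriv Y s = deriv X s - deriv X (s - T) := fun s =>
    ((hXd s).hasDerivAt.sub ((hXd (s - T)).hasDerivAt.comp_sub_const s T)).deriv
  set w : Plane → ℝ := fun z => Y (z 0) * b (z 1) with hwdef
  have hws : ContDiff ℝ 1 w := ((hYs.comp (coord 0).contDiff).mul
    (hbs.comp (coord 1).contDiff)).of_le (by simp)
  have hwc : HasCompactSupport w := by
    refine HasCompactSupport.intro (isCompact_closedBall 0 (T + η + η)) fun z hz => ?_
    have hz' : T + η + η < ‖z‖ := by simpa using hz
    have h1 := norm_le_abs_add_abs z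
    by_cases h0 : η < |z 1|
    · simp [hwdef, hb0 _ h0]
    · have h2 : T + η < |z 0| := by linarith
      rcases lt_abs.1 h2 with h | h
      · simp [hwdef, hYdef, hX1 (z 0) (by linarith), hX1 (z 0 - T) (by linarith)]
      · simp [hwdef, hYdef, hX0 (z 0) (by linarith), hX0 (z 0 - T) (by linarith)]
  have hwd : ∀ z, fderiv ℝ w z (stdVec 0) = ρ z - ρ (z - T • stdVec 0) := fun z => by
    rw [hwdef, fderiv_mul_coord_stdVec (hYs.differentiable (by simp)) (hbs.differentiable (by simp)),
      hYd]
    simp [hρdef, sub_mul]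
  obtain ⟨hi₀, he₀⟩ := H₀ ρ hρc fun z hz => hρ0 z (by rw [sub_zero] at hz; linarith)
  obtain ⟨hi₁, he₁⟩ := H₁ (fun z => ρ (z - T • stdVec 0)) (hρc.comp (continuous_id.sub continuous_const))
    fun z hz => hρ0 _ (by linarith)
  have hnull := integral_fderiv_comp_mul_det_eq_zero hU hF hP hws hwc
  simp only [hwd, sub_mul] at hnull
  rw [integral_sub hi₀ hi₁, he₀, he₁, integral_sub_right_eq_self ρ, ← mul_sub, mul_eq_zero,
    or_iff_right hρpos.ne'] at hnull
  exact sub_eq_zero.1 hnull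

/-! ### The central kernel, its derivative and its inverse -/

/-- The central field `u ↦ u / ‖u‖ ^ (β + 1)`. -/
noncomputable def kernel (β : ℝ) (u : Plane) : Plane := ‖u‖ ^ (-(β + 1)) • u

/-- The derivative of `kernel β` at `u`. -/
noncomputable def kernelDeriv (β : ℝ) (u : Plane) : Plane →L[ℝ] Plane :=
  ‖u‖ ^ (-(β + 1)) • ContinuousLinearMap.id ℝ Plane +
    (-(β + 1) * ‖u‖ ^ (-(β + 1) - 2)) • (innerSL ℝ u).smulRight u

theorem kernelDeriv_apply (β : ℝ) (u v : Plane) : kernelDeriv β u v =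
    ‖u‖ ^ (-(β + 1)) • v + (-(β + 1) * ‖u‖ ^ (-(β + 1) - 2) * ⟪u, v⟫) • u := by
  simp [kernelDeriv, smul_smul]

theorem hasFDerivAt_norm_rpow_of_ne (p : ℝ) {u : Plane} (hu : u ≠ 0) :
    HasFDerivAt (fun u : Plane => ‖u‖ ^ p) ((p * ‖u‖ ^ (p - 2)) • innerSL ℝ u) u := by
  have h0 : 0 < ‖u‖ := norm_pos_iff.2 hu
  have h1 : HasFDerivAt (fun u : Plane => ‖u‖ ^ 2) _ u := (hasStrictFDerivAt_norm_sq u).hasFDerivAt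
  have h2 := h1.rpow_const (p := p / 2) (Or.inl (by positivity))
  have e : ∀ (u : Plane) (q : ℝ), (‖u‖ ^ 2) ^ (q / 2) = ‖u‖ ^ q := fun u q => by
    rw [← Real.rpow_natCast, ← Real.rpow_mul (norm_nonneg u)]
    congr 1
    push_cast
    ring
  simp only [e] at h2
  refine h2.congr_fderiv ?_
  rw [show p / 2 - 1 = (p - 2) / 2 by ring, e]
  ext v
  simp
  ring

theorem hasFDerivAt_kernel (β : ℝ) {u : Plane} (hu : u ≠ 0) :
    HasFDerivAt (kernel β) (kernelDeriv β u) u := by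
  have h := (hasFDerivAt_norm_rpow_of_ne (-(β + 1)) hu).smul (hasFDerivAt_id u)
  refine h.congr_fderiv ?_
  ext1 v
  simp [kernelDeriv, smul_smul]

theorem contDiffAt_kernel (β : ℝ) {u : Plane} (hu : u ≠ 0) : ContDiffAt ℝ ∞ (kernel β) u :=
  ((contDiffAt_norm ℝ hu).rpow_const_of_ne (norm_ne_zero_iff.2 hu)).smul contDiffAt_id

theorem norm_kernel (β : ℝ) {u : Plane} (hu : u ≠ 0) : ‖kernel β u‖ = ‖u‖ ^ (-β) := by
  have h0 : 0 < ‖u‖ := norm_pos_iff.2 hu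
  rw [kernel, norm_smul, Real.norm_of_nonneg (by positivity), ← Real.rpow_add_one h0.ne']
  congr 1
  ring

theorem norm_kernelDeriv_le {β : ℝ} (hβ : 0 ≤ β) {u : Plane} (hu : u ≠ 0) :
    ‖kernelDeriv β u‖ ≤ (β + 2) * ‖u‖ ^ (-(β + 1)) := by
  have h0 : 0 < ‖u‖ := norm_pos_iff.2 hu
  refine ContinuousLinearMap.opNorm_le_bound _ (by positivity) fun v => ?_
  rw [kernelDeriv_apply]
  refine (norm_add_le _ _).trans ?_
  rw [norm_smul, norm_smul, Real.norm_of_nonneg (by positivity), norm_mul, norm_mul, norm_neg,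
    Real.norm_of_nonneg (by positivity : 0 ≤ β + 1), Real.norm_of_nonneg (by positivity : 0 ≤ ‖u‖ ^ (-(β + 1) - 2))]
  have h1 : ‖⟪u, v⟫‖ ≤ ‖u‖ * ‖v‖ := norm_inner_le_norm u v
  have h2 : ‖u‖ ^ (-(β + 1) - 2) * (‖u‖ * ‖u‖) = ‖u‖ ^ (-(β + 1)) := by
    rw [← pow_two, ← Real.rpow_natCast ‖u‖ 2, ← Real.rpow_add h0]
    congr 1
    push_cast
    ring
  calc _ ≤ ‖u‖ ^ (-(β + 1)) * ‖v‖ + (β + 1) * ‖u‖ ^ (-(β + 1) - 2) * (‖u‖ * ‖v‖) * ‖u‖ := by gcongr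
    _ = ‖u‖ ^ (-(β + 1)) * ‖v‖ + (β + 1) * (‖u‖ ^ (-(β + 1) - 2) * (‖u‖ * ‖u‖)) * ‖v‖ := by ring
    _ = _ := by rw [h2]; ring

theorem tendsto_norm_rpow_neg_cobounded {p : ℝ} (hp : 0 < p) :
    Tendsto (fun u : Plane => ‖u‖ ^ (-p)) (cobounded Plane) (𝓝 0) :=
  (tendsto_rpow_neg_atTop hp).comp tendsto_norm_cobounded_atTop

theorem tendsto_kernel_cobounded {β : ℝ} (hβ : 0 < β) :
    Tendsto (kernel β) (cobounded Plane) (𝓝 0) := by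
  rw [tendsto_zero_iff_norm_tendsto_zero]
  refine (tendsto_norm_rpow_neg_cobounded hβ).congr' ?_
  filter_upwards [eventually_ne_cobounded (0 : Plane)] with u hu using (norm_kernel β hu).symm

theorem tendsto_kernelDeriv_cobounded {β : ℝ} (hβ : 0 < β) :
    Tendsto (kernelDeriv β) (cobounded Plane) (𝓝 0) := by
  have h := (tendsto_norm_rpow_neg_cobounded (show 0 < β + 1 by linarith)).const_mul (β + 2)
  rw [mul_zero] at h
  refine squeeze_zero_norm' ?_ h
  filter_upwards [eventually_ne_cobounded (0 : Plane)] with u hu using norm_kernelDeriv_le hβ.le hu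

theorem tendsto_norm_rpow_neg_nhdsNE {p : ℝ} (hp : 0 < p) :
    Tendsto (fun u : Plane => ‖u‖ ^ (-p)) (𝓝[≠] 0) atTop :=
  (tendsto_rpow_neg_nhdsGT_zero (neg_neg_of_pos hp)).comp tendsto_norm_nhdsNE_zero

/-- The map `u ↦ -m • kernel β u` reverses directions and sends norm `r` to `m * r ^ (-β)`; its
inverse has the same form, with `β` replaced by `1 / β` and `m` by `m ^ (1 / β)`. -/
theorem neg_smul_kernel_of_eq {β m : ℝ} (hβ : 0 < β) (hm : 0 < m) {u z : Plane} (hu : u ≠ 0)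
    (h : z = -m • kernel β u) : u = -m ^ (1 / β) • kernel (1 / β) z := by
  have h0 : 0 < ‖u‖ := norm_pos_iff.2 hu
  have hz : ‖z‖ = m * ‖u‖ ^ (-β) := by
    rw [h, norm_smul, norm_kernel β hu, norm_neg, Real.norm_of_nonneg hm.le]
  have h1 : m ^ (1 / β) * ‖z‖ ^ (-(1 / β + 1)) * (m * ‖u‖ ^ (-(β + 1))) = 1 := by
    rw [hz, Real.mul_rpow hm.le (by positivity), ← Real.rpow_mul h0.le]
    have e1 : m ^ (1 / β) * m ^ (-(1 / β + 1)) * m = 1 := by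
      rw [← Real.rpow_add hm, ← Real.rpow_add_one hm.ne']
      convert Real.rpow_zero m using 2
      ring
    have e2 : ‖u‖ ^ (-β * -(1 / β + 1)) * ‖u‖ ^ (-(β + 1)) = 1 := by
      rw [← Real.rpow_add h0]
      convert Real.rpow_zero ‖u‖ using 2
      field_simp
      ring
    linear_combination (‖u‖ ^ (-β * -(1 / β + 1)) * ‖u‖ ^ (-(β + 1))) * e1 + e2
  rw [kernel]
  nth_rewrite 2 [h]
  rw [kernel, smul_smul, smul_smul, smul_smul]
  rw [show -m ^ (1 / β) * ‖z‖ ^ (-(1 / β + 1)) * -m * ‖u‖ ^ (-(β + 1)) =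
    m ^ (1 / β) * ‖z‖ ^ (-(1 / β + 1)) * (m * ‖u‖ ^ (-(β + 1))) by ring, h1, one_smul]

theorem kernel_ne_zero (β : ℝ) {u : Plane} (hu : u ≠ 0) : kernel β u ≠ 0 :=
  smul_ne_zero (Real.rpow_pos_of_pos (norm_pos_iff.2 hu) _).ne' hu

theorem eq_neg_smul_kernel_iff {β m : ℝ} (hβ : 0 < β) (hm : 0 < m) {u z : Plane} (hu : u ≠ 0)
    (hz : z ≠ 0) : z = -m • kernel β u ↔ u = -m ^ (1 / β) • kernel (1 / β) z := by
  refine ⟨neg_smul_kernel_of_eq hβ hm hu, fun h => ?_⟩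
  have := neg_smul_kernel_of_eq (one_div_pos.2 hβ) (Real.rpow_pos_of_pos hm (1 / β)) hz h
  rwa [one_div_one_div, ← Real.rpow_mul hm.le, one_div_mul_cancel hβ.ne', Real.rpow_one] at this

/-- Across `u` the derivative is a positive scalar, which makes the Hessian of the potential
negative in that direction near a primary. -/
theorem inner_kernelDeriv_of_inner_eq_zero (β : ℝ) {u v : Plane} (h : ⟪u, v⟫ = 0) :
    ⟪kernelDeriv β u v, v⟫ = ‖u‖ ^ (-(β + 1)) * ‖v‖ ^ 2 := by
  simp [kernelDeriv_apply, h, inner_smul_left]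

theorem inner_kernelDeriv_comm (β : ℝ) (u v w : Plane) :
    ⟪kernelDeriv β u v, w⟫ = ⟪kernelDeriv β u w, v⟫ := by
  simp only [kernelDeriv_apply, inner_add_left, inner_smul_left, real_inner_comm v w]
  simp
  ring

/-- The eigenvalues are `‖u‖ ^ (-(β + 1))` across `u` and `-β` times this along `u`. The sign of `1
- β` is where `1 ≤ α` matters for the trace of the Hessian. -/
theorem trace_kernelDeriv (β : ℝ) {u : Plane} (hu : u ≠ 0) :
    kernelDeriv β u (stdVec 0) 0 + kernelDeriv β u (stdVec 1) 1 =
      (1 - β) * ‖u‖ ^ (-(β + 1)) := by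
  have h0 : 0 < ‖u‖ := norm_pos_iff.2 hu
  have h1 : ‖u‖ ^ 2 = u 0 ^ 2 + u 1 ^ 2 := by
    simp [EuclideanSpace.norm_sq_eq, Fin.sum_univ_two]
  have h2 : ‖u‖ ^ (-(β + 1) - 2) * ‖u‖ ^ 2 = ‖u‖ ^ (-(β + 1)) := by
    rw [← Real.rpow_natCast ‖u‖ 2, ← Real.rpow_add h0]
    congr 1
    push_cast
    ring
  rw [h1] at h2
  simp [kernelDeriv_apply, EuclideanSpace.inner_single_right] at h2 ⊢
  linear_combination (-(β + 1)) * h2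

/-! ### Symmetric planar endomorphisms of positive trace -/

theorem inner_apply_self (A : Plane →L[ℝ] Plane) (v : Plane) :
    ⟪A v, v⟫ = A (stdVec 0) 0 * v 0 ^ 2 + (A (stdVec 0) 1 + A (stdVec 1) 0) * (v 0 * v 1) +
      A (stdVec 1) 1 * v 1 ^ 2 := by
  have h : A v = v 0 • A (stdVec 0) + v 1 • A (stdVec 1) := by
    conv_lhs => rw [eq_smul_stdVec_add v]
    simp
  rw [h]
  simp [PiLp.inner_apply, Fin.sum_univ_two]
  ring

section TwoByTwo

variable {A : Plane →L[ℝ] Plane} (hsymm : A (stdVec 0) 1 = A (stdVec 1) 0)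
  (htr : 0 < A (stdVec 0) 0 + A (stdVec 1) 1)
include hsymm htr

theorem det_neg_of_inner_neg {v : Plane} (hv : ⟪A v, v⟫ < 0) : A.det < 0 := by
  rw [inner_apply_self, hsymm] at hv
  rw [det_eq_stdVec, hsymm]
  by_contra! h
  set a := A (stdVec 0) 0
  set b := A (stdVec 1) 0
  set d := A (stdVec 1) 1
  -- By Cayley–Hamilton this expression, `‖A v‖² + det A * ‖v‖²`, equals `tr A * ⟪A v, v⟫`, which is
  -- negative.
  have h1 : 0 ≤ (a * v 0 + b * v 1) ^ 2 + (b * v 0 + d * v 1) ^ 2 +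
      (a * d - b * b) * (v 0 ^ 2 + v 1 ^ 2) := by positivity
  nlinarith

theorem exists_inner_neg_of_det_neg (h : A.det < 0) : ∃ v, ⟪A v, v⟫ < 0 := by
  rw [det_eq_stdVec, hsymm] at h
  -- Some diagonal entry is positive. The witness, a column of the adjugate up to sign, gives the
  -- quadratic form the value of that entry times the determinant.
  by_cases h0 : 0 < A (stdVec 0) 0
  · refine ⟨!₂[-A (stdVec 1) 0, A (stdVec 0) 0], ?_⟩
    rw [inner_apply_self, hsymm]
    simp
    nlinarith
  · refine ⟨!₂[A (stdVec 1) 1, -A (stdVec 1) 0], ?_⟩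
    rw [inner_apply_self, hsymm]
    have h1 : 0 < A (stdVec 1) 1 := by linarith
    simp
    nlinarith

theorem exists_coercive_of_det_pos (h : 0 < A.det) : ∃ c > 0, ∀ v, c * ‖v‖ ^ 2 ≤ ⟪A v, v⟫ := by
  -- The constant `det A / tr A` comes from the same identity, on dropping `‖A v‖²`.
  refine ⟨A.det / (A (stdVec 0) 0 + A (stdVec 1) 1), div_pos h htr, fun v => ?_⟩
  rw [inner_apply_self, det_eq_stdVec, hsymm, EuclideanSpace.norm_sq_eq, Fin.sum_univ_two,
    div_mul_eq_mul_div, div_le_iff₀ htr]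
  simp only [Real.norm_eq_abs, sq_abs]
  nlinarith [sq_nonneg (A (stdVec 0) 0 * v 0 + A (stdVec 1) 0 * v 1),
    sq_nonneg (A (stdVec 1) 0 * v 0 + A (stdVec 1) 1 * v 1)]

end TwoByTwo

/-! ### Second derivative tests in terms of a gradient field -/

section SecondDerivativeTest

variable {f : Plane → ℝ} {F : Plane → Plane} {A : Plane →L[ℝ] Plane} {x : Plane}

theorem not_isLocalMin_of_inner_neg (hf : ∀ᶠ z in 𝓝 x, HasFDerivAt f (innerSL ℝ (F z)) z)
    (hF : HasFDerivAt F A x) {v : Plane} (hv : ⟪A v, v⟫ < 0) : ¬ IsLocalMin f x := by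
  intro hmin
  have hFx : innerSL ℝ (F x) = 0 := hmin.hasFDerivAt_eq_zero hf.self_of_nhds
  have hl : ∀ t : ℝ, HasDerivAt (fun t : ℝ => x + t • v) v t := fun t => by
    simpa using ((hasDerivAt_id t).smul_const v).const_add x
  have hlim : Tendsto (fun t : ℝ => x + t • v) (𝓝 0) (𝓝 x) := by
    simpa using (hl 0).continuousAt.tendsto
  set g : ℝ → ℝ := fun t => f (x + t • v) with hg
  have hgd : ∀ᶠ t in 𝓝 (0 : ℝ), HasDerivAt g ⟪F (x + t • v), v⟫ t := by
    filter_upwards [hlim.eventually hf] with t ht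
    exact ht.comp_hasDerivAt t (hl t)
  have hg1 : deriv g =ᶠ[𝓝 0] fun t => ⟪F (x + t • v), v⟫ := hgd.mono fun t ht => ht.deriv
  have hF' : HasFDerivAt F A (x + (0 : ℝ) • v) := by simpa using hF
  have hg2 : deriv (deriv g) 0 = ⟪A v, v⟫ := by
    rw [hg1.deriv_eq]
    have := (hF'.comp_hasDerivAt (0 : ℝ) (hl 0)).inner ℝ (hasDerivAt_const (0 : ℝ) v)
    simpa using this.deriv
  -- The test yields only a non-strict maximum; combined with the minimum it makes `g` constant near
  -- `0`, against its negative second derivative.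
  have hmax : IsLocalMax g 0 := isLocalMax_of_deriv_deriv_neg (by rwa [hg2])
    (by rw [hg1.self_of_nhds]; simpa using congrArg (fun L => L v) hFx)
    hgd.self_of_nhds.continuousAt
  have hmin' : IsLocalMin g 0 := by
    have := hlim.eventually hmin
    filter_upwards [this] with t ht
    simpa [hg] using ht
  have hconst : g =ᶠ[𝓝 0] fun _ => g 0 := by
    filter_upwards [hmax, hmin'] with t h1 h2 using le_antisymm h1 h2
  have h3 : deriv (deriv g) 0 = 0 := by
    rw [hconst.deriv.deriv_eq]
    simp
  linarith

theorem not_isLocalMax_of_inner_pos (hf : ∀ᶠ z in 𝓝 x, HasFDerivAt f (innerSL ℝ (F z)) z)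
    (hF : HasFDerivAt F A x) {v : Plane} (hv : 0 < ⟪A v, v⟫) : ¬ IsLocalMax f x := by
  intro hmax
  refine not_isLocalMin_of_inner_neg (f := -f) (F := -F) (A := -A) (v := v) ?_ hF.neg
    (by simpa using hv) hmax.neg
  filter_upwards [hf] with z hz
  simpa using hz.neg

/-- Since `F z = A (z - x) + o(‖z - x‖)`, coercivity makes the radial component of the gradient
nonnegative near `x`, so `f` is nondecreasing along short segments issuing from `x`. -/
theorem isLocalMin_of_coercive (hf : ∀ᶠ z in 𝓝 x, HasFDerivAt f (innerSL ℝ (F z)) z)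
    (hF : HasFDerivAt F A x) (hFx : F x = 0) {c : ℝ} (hc : 0 < c)
    (hA : ∀ v, c * ‖v‖ ^ 2 ≤ ⟪A v, v⟫) : IsLocalMin f x := by
  obtain ⟨r, hr, hball⟩ := Metric.eventually_nhds_iff_ball.1 (hf.and (hF.isLittleO.def hc))
  have hpos : ∀ z ∈ Metric.ball x r, 0 ≤ ⟪F z, z - x⟫ := by
    intro z hz
    have h1 := (hball z hz).2
    rw [hFx, sub_zero] at h1
    have h2 : ⟪F z, z - x⟫ = ⟪A (z - x), z - x⟫ + ⟪F z - A (z - x), z - x⟫ := by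
      rw [← inner_add_left, add_sub_cancel]
    have h3 := abs_le.1 (abs_real_inner_le_norm (F z - A (z - x)) (z - x))
    have h4 := hA (z - x)
    have h5 : ‖F z - A (z - x)‖ * ‖z - x‖ ≤ c * ‖z - x‖ * ‖z - x‖ := by gcongr
    nlinarith [h3.1]
  filter_upwards [Metric.ball_mem_nhds x hr] with z hz
  set v := z - x with hv
  have hl : ∀ t : ℝ, HasDerivAt (fun t : ℝ => x + t • v) v t := fun t => by
    simpa using ((hasDerivAt_id t).smul_const v).const_add x
  have hmem : ∀ t ∈ Icc (0 : ℝ) 1, x + t • v ∈ Metric.ball x r := fun t ht => by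
    rw [mem_ball_iff_norm] at hz ⊢
    rw [add_sub_cancel_left, norm_smul, Real.norm_of_nonneg ht.1]
    nlinarith [norm_nonneg v, ht.2]
  have hgd : ∀ t ∈ Icc (0 : ℝ) 1, HasDerivAt (fun t => f (x + t • v)) ⟪F (x + t • v), v⟫ t :=
    fun t ht => by
      have h := (hball _ (hmem t ht)).1
      exact h.comp_hasDerivAt t (hl t)
  have hmono : MonotoneOn (fun t => f (x + t • v)) (Icc (0 : ℝ) 1) := by
    refine monotoneOn_of_deriv_nonneg (convex_Icc 0 1)
      (fun t ht => (hgd t ht).continuousAt.continuousWithinAt)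
      (fun t ht => (hgd t (interior_subset ht)).differentiableAt.differentiableWithinAt)
      fun t ht => ?_
    rw [(hgd t (interior_subset ht)).deriv]
    rw [interior_Icc] at ht
    have h1 := hpos _ (hmem t (Ioo_subset_Icc_self ht))
    rw [add_sub_cancel_left, inner_smul_right] at h1
    exact nonneg_of_mul_nonneg_right h1 ht.1
  have := hmono (left_mem_Icc.2 zero_le_one) (right_mem_Icc.2 zero_le_one) zero_le_one
  simpa [hv] using this

end SecondDerivativeTest

/-! ### The potential, its gradient and its Hessian -/

/-- For `α = 1` the potential `-log r` is unbounded below, but a linear loss is absorbed by `‖x‖ ^ 2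
/ 2` at infinity. -/
theorem neg_le_phi {α r : ℝ} (hα : 1 ≤ α) (hr : 0 < r) : -r ≤ phi α r := by
  unfold phi
  split_ifs with h
  · linarith [Real.log_le_sub_one_of_pos hr]
  · have h1 : 0 < α - 1 := sub_pos.2 (lt_of_le_of_ne hα (Ne.symm h))
    have h2 : 0 ≤ r ^ (1 - α) / (α - 1) := by positivity
    linarith

theorem tendsto_phi_nhdsGT_zero {α : ℝ} (hα : 1 ≤ α) : Tendsto (phi α) (𝓝[>] 0) atTop := by
  by_cases h : α = 1
  · subst h
    have h1 : phi 1 = fun r => -Real.log r := by funext r; simp [phi]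
    rw [h1]
    exact tendsto_neg_atBot_atTop.comp Real.tendsto_log_nhdsGT_zero
  · have h0 : 0 < α - 1 := sub_pos.2 (lt_of_le_of_ne hα (Ne.symm h))
    have h1 : phi α = fun r => r ^ (1 - α) / (α - 1) := by funext r; simp [phi, h]
    rw [h1]
    exact (tendsto_rpow_neg_nhdsGT_zero (by linarith)).atTop_div_const h0

variable {n : ℕ}

theorem isOpen_freeRegion (a : Fin n → Plane) : IsOpen (freeRegion a) :=
  (finite_range a).isClosed.isOpen_compl

theorem mem_freeRegion {a : Fin n → Plane} {x : Plane} : x ∈ freeRegion a ↔ ∀ j, x - a j ≠ 0 := by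
  simp [freeRegion, sub_ne_zero, eq_comm]

/-- The contribution to `∇V` of the primaries with index in `s`, with the opposite sign. -/
noncomputable def attraction (α : ℝ) (m : Fin n → ℝ) (a : Fin n → Plane) (s : Finset (Fin n))
    (x : Plane) : Plane :=
  ∑ j ∈ s, m j • kernel α (x - a j)

/-- The derivative of `attraction`. -/
noncomputable def attractionDeriv (α : ℝ) (m : Fin n → ℝ) (a : Fin n → Plane) (s : Finset (Fin n))
    (x : Plane) : Plane →L[ℝ] Plane :=
  ∑ j ∈ s, m j • kernelDeriv α (x - a j)

/-- The gradient of `potential α m a` on the free region. -/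
noncomputable def force (α : ℝ) (m : Fin n → ℝ) (a : Fin n → Plane) (x : Plane) : Plane :=
  x - attraction α m a Finset.univ x

/-- The Hessian of `potential α m a` on the free region, as an endomorphism. -/
noncomputable def forceDeriv (α : ℝ) (m : Fin n → ℝ) (a : Fin n → Plane) (x : Plane) :
    Plane →L[ℝ] Plane :=
  ContinuousLinearMap.id ℝ Plane - attractionDeriv α m a Finset.univ x

variable {α : ℝ} {m : Fin n → ℝ} {a : Fin n → Plane}

theorem hasFDerivAt_attraction {s : Finset (Fin n)} {x : Plane} (hx : ∀ j ∈ s, x - a j ≠ 0) :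
    HasFDerivAt (attraction α m a s) (attractionDeriv α m a s x) x := by
  refine HasFDerivAt.fun_sum fun j hj => HasFDerivAt.const_smul ?_ (m j)
  exact (hasFDerivAt_kernel α (hx j hj)).comp x ((hasFDerivAt_id x).sub_const (a j))

theorem contDiffAt_attraction {s : Finset (Fin n)} {x : Plane} (hx : ∀ j ∈ s, x - a j ≠ 0) :
    ContDiffAt ℝ ∞ (attraction α m a s) x :=
  ContDiffAt.sum fun j hj => ((contDiffAt_kernel α (hx j hj)).comp x
    (contDiffAt_id.sub contDiffAt_const)).const_smul (m j)

theorem continuousAt_attractionDeriv {s : Finset (Fin n)} {x : Plane}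
    (hx : ∀ j ∈ s, x - a j ≠ 0) : ContinuousAt (attractionDeriv α m a s) x := by
  have h : ∀ᶠ z in 𝓝 x, ∀ j ∈ s, z - a j ≠ 0 := (s.eventually_all).2 fun j hj =>
    (continuousAt_id.sub continuousAt_const).eventually_ne (hx j hj)
  refine (((contDiffAt_attraction (α := α) (m := m) hx).fderiv_right (m := 0) (by simp)).continuousAt).congr ?_
  filter_upwards [h] with z hz using (hasFDerivAt_attraction hz).fderiv

theorem hasFDerivAt_force {x : Plane} (hx : x ∈ freeRegion a) :
    HasFDerivAt (force α m a) (forceDeriv α m a x) x :=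
  (hasFDerivAt_id x).sub (hasFDerivAt_attraction fun j _ => mem_freeRegion.1 hx j)

theorem contDiffOn_force : ContDiffOn ℝ ∞ (force α m a) (freeRegion a) := fun _ hx =>
  (contDiffAt_id.sub (contDiffAt_attraction fun j _ => mem_freeRegion.1 hx j)).contDiffWithinAt

theorem hasFDerivAt_potential {x : Plane} (hx : x ∈ freeRegion a) :
    HasFDerivAt (potential α m a) (innerSL ℝ (force α m a x)) x := by
  have h1 : HasFDerivAt (fun x : Plane => ‖x‖ ^ 2 / 2) (innerSL ℝ x) x := by
    have := (hasStrictFDerivAt_norm_sq x).hasFDerivAt.mul_const ((2 : ℝ)⁻¹)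
    refine (this.congr_fderiv ?_)
    ext v
    simp
  have h2 : ∀ j, HasFDerivAt (fun x => m j * phi α ‖x - a j‖)
      (-innerSL ℝ (m j • kernel α (x - a j))) x := by
    intro j
    have hj := mem_freeRegion.1 hx j
    have hj0 : 0 < ‖x - a j‖ := norm_pos_iff.2 hj
    have h3 : HasFDerivAt (fun x => ‖x - a j‖)
        (((1 : ℝ) * ‖x - a j‖ ^ ((1 : ℝ) - 2)) • innerSL ℝ (x - a j)) x := by
      have := (hasFDerivAt_norm_rpow_of_ne 1 hj).comp x ((hasFDerivAt_id x).sub_const (a j))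
      simpa only [Real.rpow_one] using! this
    have h4 := (hasDerivAt_phi α hj0).comp_hasFDerivAt x h3
    refine (h4.const_mul (m j)).congr_fderiv ?_
    have h5 : -1 / ‖x - a j‖ ^ α * ‖x - a j‖ ^ ((1 : ℝ) - 2) = -‖x - a j‖ ^ (-(α + 1)) := by
      rw [neg_div, one_div, ← Real.rpow_neg hj0.le, neg_mul, ← Real.rpow_add hj0]
      congr 2
      ring
    ext v
    simp only [kernel, smul_apply, neg_apply, innerSL_apply_apply, inner_smul_left, smul_eq_mul,
      one_mul, RCLike.conj_to_real]
    linear_combination (m j * ⟪x - a j, v⟫) * h5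
  have h6 : HasFDerivAt (potential α m a) _ x := h1.add (HasFDerivAt.fun_sum fun j _ => h2 j)
  refine h6.congr_fderiv ?_
  rw [force, attraction, map_sub, map_sum, Finset.sum_neg_distrib, sub_eq_add_neg]

theorem attractionDeriv_symm (x : Plane) :
    attractionDeriv α m a Finset.univ x (stdVec 0) 1 =
      attractionDeriv α m a Finset.univ x (stdVec 1) 0 := by
  have h : ∀ j, kernelDeriv α (x - a j) (stdVec 0) 1 = kernelDeriv α (x - a j) (stdVec 1) 0 :=
    fun j => by
      simpa [EuclideanSpace.inner_single_right] using
        inner_kernelDeriv_comm α (x - a j) (stdVec 0) (stdVec 1)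
  simp [attractionDeriv, h]

theorem forceDeriv_symm (x : Plane) :
    forceDeriv α m a x (stdVec 0) 1 = forceDeriv α m a x (stdVec 1) 0 := by
  simp [forceDeriv, attractionDeriv_symm]

/-- The identity contributes `2`, and each primary a nonnegative multiple of `α - 1`. -/
theorem trace_forceDeriv_pos (hα : 1 ≤ α) (hm : ∀ j, 0 < m j) {x : Plane}
    (hx : x ∈ freeRegion a) :
    0 < forceDeriv α m a x (stdVec 0) 0 + forceDeriv α m a x (stdVec 1) 1 := by
  have h1 : ∀ j, m j * kernelDeriv α (x - a j) (stdVec 0) 0 +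
      m j * kernelDeriv α (x - a j) (stdVec 1) 1 ≤ 0 := fun j => by
    rw [← mul_add, trace_kernelDeriv α (mem_freeRegion.1 hx j)]
    exact mul_nonpos_of_nonneg_of_nonpos (hm j).le
      (mul_nonpos_of_nonpos_of_nonneg (by linarith) (by positivity))
  have h2 := Finset.sum_nonpos fun j (_ : j ∈ Finset.univ) => h1 j
  rw [Finset.sum_add_distrib] at h2
  simp [forceDeriv, attractionDeriv]
  linarith

/-! ### Behaviour at infinity and at the primaries -/

/-- A function tending to infinity at infinity and at the primaries is large off a compact subset
of the free region. -/
theorem exists_isCompact_lt_of_tendsto {g : Plane → ℝ} (hg : Tendsto g (cobounded Plane) atTop)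
    (hga : ∀ i, Tendsto g (𝓝[≠] a i) atTop) (R : ℝ) :
    ∃ K, IsCompact K ∧ K ⊆ freeRegion a ∧ ∀ x ∈ freeRegion a \ K, R < g x := by
  obtain ⟨r, -, hr⟩ := (hasBasis_cobounded_norm.eventually_iff).1 (hg.eventually_gt_atTop R)
  have h1 : ∀ i, ∃ N, IsOpen N ∧ a i ∈ N ∧ ∀ x ∈ N, x ≠ a i → R < g x := fun i => by
    obtain ⟨N, hN, hNo, haN⟩ :=
      eventually_nhds_iff.1 (eventually_nhdsWithin_iff.1 ((hga i).eventually_gt_atTop R))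
    exact ⟨N, hNo, haN, fun x hx hxa => hN x hx hxa⟩
  choose N hNo haN hN using h1
  refine ⟨Metric.closedBall 0 r \ ⋃ i, N i, (isCompact_closedBall 0 r).diff (isOpen_iUnion hNo),
    ?_, ?_⟩
  · rintro x ⟨-, hx⟩ ⟨i, rfl⟩
    exact hx (mem_iUnion.2 ⟨i, haN i⟩)
  · rintro x ⟨hxU, hx⟩
    by_cases hxr : x ∈ Metric.closedBall 0 r
    · obtain ⟨i, hi⟩ := mem_iUnion.1 (not_not.1 fun h => hx ⟨hxr, h⟩)
      exact hN i x hi fun h => hxU ⟨i, h.symm⟩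
    · exact hr (by simpa using (not_le.1 (fun h => hxr (by simpa using h))).le)

theorem tendsto_potential_cobounded (hα : 1 ≤ α) (hm : ∀ j, 0 < m j) :
    Tendsto (potential α m a) (cobounded Plane) atTop := by
  have h1 : ∀ᶠ x in cobounded Plane, ∀ j, x - a j ≠ 0 := eventually_all.2 fun j => by
    filter_upwards [eventually_ne_cobounded (a j)] with x hx using sub_ne_zero.2 hx
  have h2 : Tendsto (fun r : ℝ => r * (r / 2 - ∑ j, m j) - ∑ j, m j * ‖a j‖) atTop atTop :=
    tendsto_atTop_add_const_right _ _ (tendsto_id.atTop_mul_atTop₀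
      (tendsto_atTop_add_const_right _ _ (tendsto_id.atTop_div_const two_pos)))
  refine tendsto_atTop_mono' _ ?_ (h2.comp tendsto_norm_cobounded_atTop)
  filter_upwards [h1] with x hx
  have h3 : ∀ j, -(m j * ‖x‖ + m j * ‖a j‖) ≤ m j * phi α ‖x - a j‖ := fun j => by
    have h4 := neg_le_phi hα (norm_pos_iff.2 (hx j))
    have h5 := norm_sub_le x (a j)
    nlinarith [hm j]
  have h6 := Finset.sum_le_sum fun j (_ : j ∈ Finset.univ) => h3 j
  rw [Finset.sum_neg_distrib, Finset.sum_add_distrib, ← Finset.sum_mul] at h6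
  simp only [Function.comp, potential]
  nlinarith

theorem tendsto_potential_nhdsNE (hα : 1 ≤ α) (hm : ∀ j, 0 < m j) (ha : Function.Injective a)
    (i : Fin n) : Tendsto (potential α m a) (𝓝[≠] a i) atTop := by
  have h1 : Tendsto (fun x : Plane => ‖x - a i‖) (𝓝[≠] a i) (𝓝[>] 0) := tendsto_norm_sub_self_nhdsNE (a i)
  have h2 := ((tendsto_phi_nhdsGT_zero hα).comp h1).const_mul_atTop (hm i)
  have h3 : ContinuousAt (fun x => ‖x‖ ^ 2 / 2 + ∑ j ∈ Finset.univ.erase i, m j * phi α ‖x - a j‖)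
      (a i) := by
    refine ContinuousAt.add (by fun_prop) (tendsto_finsetSum _ fun j hj => ?_)
    have h4 : 0 < ‖a i - a j‖ := norm_sub_pos_iff.2 (ha.ne (Finset.ne_of_mem_erase hj).symm)
    refine (ContinuousAt.comp (f := fun x : Plane => ‖x - a j‖)
      (hasDerivAt_phi α h4).continuousAt (by fun_prop)).tendsto.const_mul (m j)
  refine ((h3.tendsto.mono_left nhdsWithin_le_nhds).add_atTop h2).congr fun x => ?_
  rw [potential, ← Finset.sum_erase_add _ _ (Finset.mem_univ i), add_assoc]
  rfl

theorem tendsto_attraction_cobounded (hα : 1 ≤ α) (s : Finset (Fin n)) :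
    Tendsto (attraction α m a s) (cobounded Plane) (𝓝 0) := by
  rw [← Finset.sum_const_zero (s := s) (M := Plane)]
  refine tendsto_finsetSum s fun j _ => ?_
  have h := ((tendsto_kernel_cobounded (show 0 < α by linarith)).comp
    (tendsto_sub_const_cobounded (a j))).const_smul (m j)
  rwa [smul_zero] at h

theorem tendsto_attractionDeriv_cobounded (hα : 1 ≤ α) (s : Finset (Fin n)) :
    Tendsto (attractionDeriv α m a s) (cobounded Plane) (𝓝 0) := by
  rw [← Finset.sum_const_zero (s := s) (M := Plane →L[ℝ] Plane)]
  refine tendsto_finsetSum s fun j _ => ?_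
  have h := ((tendsto_kernelDeriv_cobounded (show 0 < α by linarith)).comp
    (tendsto_sub_const_cobounded (a j))).const_smul (m j)
  rw [show m j • (0 : Plane →L[ℝ] Plane) = 0 by ext; simp] at h
  exact h

theorem tendsto_norm_force_cobounded (hα : 1 ≤ α) :
    Tendsto (fun x => ‖force α m a x‖) (cobounded Plane) atTop := by
  refine tendsto_atTop_mono (fun x => norm_sub_norm_le x (attraction α m a Finset.univ x)) ?_
  simp only [sub_eq_add_neg]
  exact tendsto_norm_cobounded_atTop.atTop_add (tendsto_attraction_cobounded hα _).norm.neg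

/-- Isolates the only term singular at `a i`; the bracket is smooth there when the primaries are
distinct. -/
theorem force_eq_sub (i : Fin n) (x : Plane) : force α m a x =
    (x - attraction α m a (Finset.univ.erase i) x) - m i • kernel α (x - a i) := by
  rw [force, attraction, ← Finset.sum_erase_add _ _ (Finset.mem_univ i), ← sub_sub]
  rfl

theorem tendsto_sub_nhdsNE (c : Plane) : Tendsto (fun x => x - c) (𝓝[≠] c) (𝓝[≠] 0) :=
  tendsto_nhdsWithin_iff.2 ⟨by
    have : ContinuousAt (fun x => x - c) c := by fun_prop
    simpa [ContinuousAt] using this.tendsto.mono_left nhdsWithin_le_nhds,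
    by filter_upwards [self_mem_nhdsWithin] with x hx using sub_ne_zero.2 hx⟩

theorem sub_ne_zero_of_mem_erase (ha : Function.Injective a) {i j : Fin n}
    (hj : j ∈ Finset.univ.erase i) : a i - a j ≠ 0 :=
  sub_ne_zero.2 (ha.ne (Finset.ne_of_mem_erase hj).symm)

theorem tendsto_norm_force_nhdsNE (hα : 1 ≤ α) (hm : ∀ j, 0 < m j) (ha : Function.Injective a)
    (i : Fin n) : Tendsto (fun x => ‖force α m a x‖) (𝓝[≠] a i) atTop := by
  have h1 := ((tendsto_norm_rpow_neg_nhdsNE (show 0 < α by linarith)).comp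
    (tendsto_sub_nhdsNE (a i))).const_mul_atTop (hm i)
  have h2 : ContinuousAt (fun x => x - attraction α m a (Finset.univ.erase i) x) (a i) :=
    continuousAt_id.sub (contDiffAt_attraction fun j hj =>
      sub_ne_zero_of_mem_erase ha hj).continuousAt
  refine tendsto_atTop_mono' _ ?_ (h1.atTop_add (h2.norm.tendsto.mono_left nhdsWithin_le_nhds).neg)
  filter_upwards [self_mem_nhdsWithin] with x hx
  have h3 := norm_sub_norm_le (m i • kernel α (x - a i))
    (x - attraction α m a (Finset.univ.erase i) x)
  rw [norm_sub_rev (m i • kernel α (x - a i)), ← force_eq_sub, norm_smul, norm_kernel α (sub_ne_zero.2 hx),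
    Real.norm_of_nonneg (hm i).le] at h3
  exact h3

theorem isProperOn_force (hα : 1 ≤ α) (hm : ∀ j, 0 < m j) (ha : Function.Injective a) :
    IsProperOn (force α m a) (freeRegion a) :=
  exists_isCompact_lt_of_tendsto (tendsto_norm_force_cobounded hα)
    (tendsto_norm_force_nhdsNE hα hm ha)

theorem exists_forall_potential_le (hα : 1 ≤ α) (hm : ∀ j, 0 < m j) (ha : Function.Injective a) :
    ∃ x ∈ freeRegion a, ∀ y ∈ freeRegion a, potential α m a x ≤ potential α m a y := by
  obtain ⟨x₀, hx₀⟩ : (freeRegion a).Nonempty :=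
    (finite_range a).infinite_compl.nonempty
  obtain ⟨K, hK, hKU, hKV⟩ := exists_isCompact_lt_of_tendsto
    (tendsto_potential_cobounded hα hm) (tendsto_potential_nhdsNE hα hm ha) (potential α m a x₀)
  have hx₀K : x₀ ∈ K := by
    by_contra h
    exact lt_irrefl _ (hKV x₀ ⟨hx₀, h⟩)
  obtain ⟨x, hx, hmin⟩ := hK.exists_isMinOn ⟨x₀, hx₀K⟩ (f := potential α m a)
    fun z hz => (hasFDerivAt_potential (hKU hz)).continuousAt.continuousWithinAt
  refine ⟨x, hKU hx, fun y hy => ?_⟩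
  by_cases hyK : y ∈ K
  · exact hmin hyK
  · exact (hmin hx₀K).trans (hKV y ⟨hy, hyK⟩).le

/-! ### The fibre of the force over a far value -/

theorem existsUnique_fixedPoint_closedBall {g : Plane → Plane} {c : Plane} {r : ℝ} (hr : 0 ≤ r)
    {K : NNReal} (hK : K < 1) (hg : MapsTo g (Metric.closedBall c r) (Metric.closedBall c r))
    (hL : LipschitzOnWith K g (Metric.closedBall c r)) :
    ∃! x, x ∈ Metric.closedBall c r ∧ g x = x := by
  have hcon : ContractingWith K (hg.restrict g _ _) := ⟨hK, hL.mapsToRestrict hg⟩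
  obtain ⟨x, hx, hfix, -⟩ := hcon.exists_fixedPoint' Metric.isClosed_closedBall.isComplete hg
    (Metric.mem_closedBall_self hr) (edist_ne_top _ _)
  refine ⟨x, ⟨hx, hfix⟩, fun y hy => ?_⟩
  have := hcon.fixedPoint_unique' (x := ⟨y, hy.1⟩) (y := ⟨x, hx⟩) (Subtype.ext hy.2)
    (Subtype.ext hfix)
  exact congrArg Subtype.val this

theorem lipschitzOnWith_of_hasFDerivAt {g : Plane → Plane} {g' : Plane → Plane →L[ℝ] Plane}
    {s : Set Plane} (hs : Convex ℝ s) {K : NNReal} (hg : ∀ x ∈ s, HasFDerivAt g (g' x) x)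
    (hK : ∀ x ∈ s, ‖g' x‖ ≤ K) : LipschitzOnWith K g s :=
  hs.lipschitzOnWith_of_nnnorm_hasFDerivWithin_le (fun x hx => (hg x hx).hasFDerivWithinAt) hK

theorem closedBall_subset_of_lt_norm {R C T : ℝ} (hT : R + C < T) {z : Plane}
    (hz : z ∈ Metric.closedBall (T • stdVec 0) C) : R < ‖z‖ := by
  have h1 : ‖T • stdVec 0 - z‖ ≤ C := by rw [norm_sub_rev]; simpa [dist_eq_norm] using hz
  have h2 := norm_sub_norm_le (T • stdVec 0) (T • stdVec 0 - z)
  have h3 : ‖T • stdVec 0‖ = |T| := by simp [norm_smul]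
  rw [sub_sub_cancel, h3] at h2
  linarith [le_abs_self T]

/-- Near infinity the force takes each large value exactly once. -/
theorem exists_forall_existsUnique_force_cobounded (hα : 1 ≤ α) : ∃ R₀ : ℝ, ∀ R ≥ R₀,
    ∀ᶠ T : ℝ in atTop, ∃! x : Plane, R < ‖x‖ ∧ force α m a x = T • stdVec 0 := by
  have h1 : ∀ᶠ x in cobounded Plane, ∀ j, x - a j ≠ 0 := eventually_all.2 fun j => by
    filter_upwards [eventually_ne_cobounded (a j)] with x hx using sub_ne_zero.2 hx
  have h2 : ∀ᶠ x in cobounded Plane, ‖attraction α m a Finset.univ x‖ < 1 :=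
    (tendsto_attraction_cobounded hα _).norm.eventually (gt_mem_nhds (by simp))
  have h3 : ∀ᶠ x in cobounded Plane, ‖attractionDeriv α m a Finset.univ x‖ < 1 / 2 :=
    (tendsto_attractionDeriv_cobounded hα _).norm.eventually (gt_mem_nhds (by simp))
  obtain ⟨R₀, -, hR₀⟩ := (hasBasis_cobounded_norm.eventually_iff).1 (h1.and (h2.and h3))
  refine ⟨R₀, fun R hR => ?_⟩
  filter_upwards [eventually_gt_atTop (R + 1)] with T hT
  have hmem : ∀ x ∈ Metric.closedBall (T • stdVec 0) 1, R < ‖x‖ := fun x hx =>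
    closedBall_subset_of_lt_norm hT hx
  have hfar : ∀ x : Plane, R < ‖x‖ → _ := fun x hx => hR₀ (show R₀ ≤ ‖x‖ from hR.trans hx.le)
  -- The equation reads `x = T • stdVec 0 + attraction x`. Far out the attraction has norm below `1`
  -- and derivative below `1 / 2`, so this is a contraction of the unit ball, and every far solution
  -- lies in that ball.
  have hfix := existsUnique_fixedPoint_closedBall (c := T • stdVec 0) (r := 1)
    (g := fun x => T • stdVec 0 + attraction α m a Finset.univ x) zero_le_one
    (K := 1 / 2) (by rw [← NNReal.coe_lt_coe]; norm_num)
    (fun x hx => by simpa using (hfar x (hmem x hx)).2.1.le)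
    (lipschitzOnWith_of_hasFDerivAt (convex_closedBall _ _)
      (fun x hx => (hasFDerivAt_attraction fun j _ => (hfar x (hmem x hx)).1 j).const_add _)
      (fun x hx => by simpa using (hfar x (hmem x hx)).2.2.le))
  refine (existsUnique_congr fun x => ?_).1 hfix
  have heq : T • stdVec 0 + attraction α m a Finset.univ x = x ↔
      force α m a x = T • stdVec 0 := by
    rw [force, sub_eq_iff_eq_add, eq_comm]
  rw [heq]
  refine and_congr_left fun h => ⟨hmem x, fun hx => ?_⟩
  have := (hfar x hx).2.1.le
  rw [← heq] at h
  rw [mem_closedBall_iff_norm]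
  nth_rewrite 1 [← h]
  simpa using this

/-- Near a primary the force takes each large value exactly once. -/
theorem exists_forall_existsUnique_force_nhdsNE (hα : 1 ≤ α) (hm : ∀ j, 0 < m j)
    (ha : Function.Injective a) (i : Fin n) : ∃ δ₀ > 0, ∀ δ > 0, δ ≤ δ₀ →
      ∀ᶠ T : ℝ in atTop, ∃! x : Plane, (x ≠ a i ∧ ‖x - a i‖ ≤ δ) ∧
        force α m a x = T • stdVec 0 := by
  have hα0 : 0 < α := by linarith
  -- With `B` the part regular at `a i`, the equation says that `T • stdVec 0 - B x` equals `-m i •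
  -- kernel α (x - a i)`. Inverting the kernel gives the fixed-point problem `x = a i + M • kernel
  -- (1 / α) (T • stdVec 0 - B x)`.
  set B : Plane → Plane := fun x => x - attraction α m a (Finset.univ.erase i) x with hB
  have hBs : ContDiffAt ℝ 1 B (a i) := (contDiffAt_id.sub (contDiffAt_attraction fun j hj =>
    sub_ne_zero_of_mem_erase ha hj)).of_le (by simp)
  obtain ⟨L, t, ht, hL⟩ := hBs.exists_lipschitzOnWith
  obtain ⟨δ₀, hδ₀, hδt⟩ := Metric.nhds_basis_closedBall.mem_iff.1 ht
  refine ⟨δ₀, hδ₀, fun δ hδ hδδ₀ => ?_⟩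
  have hsub : Metric.closedBall (a i) δ ⊆ t := (Metric.closedBall_subset_closedBall hδδ₀).trans hδt
  set C : ℝ := ‖B (a i)‖ + L * δ with hC
  have hBC : ∀ x ∈ Metric.closedBall (a i) δ, ‖B x‖ ≤ C := fun x hx => by
    have h1 := (hL.mono hsub).norm_sub_le hx (Metric.mem_closedBall_self hδ.le)
    have h2 := norm_le_norm_add_norm_sub' (B x) (B (a i))
    have h3 : (L : ℝ) * ‖x - a i‖ ≤ L * δ := by
      gcongr
      simpa [dist_eq_norm] using hx
    linarith
  set M : ℝ := -m i ^ (1 / α) with hM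
  have hlim : Tendsto (fun z => M • kernel (1 / α) z) (cobounded Plane) (𝓝 0) := by
    have h := (tendsto_kernel_cobounded (one_div_pos.2 hα0)).const_smul M
    rwa [smul_zero] at h
  have hlim' : Tendsto (fun z => |M| * ‖kernelDeriv (1 / α) z‖) (cobounded Plane) (𝓝 0) := by
    simpa using (tendsto_kernelDeriv_cobounded (one_div_pos.2 hα0)).norm.const_mul |M|
  -- The inverse kernel is `κ`-Lipschitz far out and `B` is `L`-Lipschitz; this choice makes `κ * L
  -- < 1`.
  set κ : NNReal := (2 * (L + 1))⁻¹ with hκ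
  have hκ0 : 0 < (κ : ℝ) := by rw [NNReal.coe_pos]; positivity
  obtain ⟨R, -, hR⟩ := (hasBasis_cobounded_norm.eventually_iff).1
    ((eventually_ne_cobounded (0 : Plane)).and
      ((hlim.norm.eventually (gt_mem_nhds (by simpa using hδ))).and
        (hlim'.eventually (gt_mem_nhds hκ0))))
  filter_upwards [eventually_gt_atTop (R + C)] with T hT
  have hfar : ∀ z ∈ Metric.closedBall (T • stdVec 0) C, _ := fun z hz =>
    hR (show R ≤ ‖z‖ from (closedBall_subset_of_lt_norm hT hz).le)
  have hz : MapsTo (fun x => T • stdVec 0 - B x) (Metric.closedBall (a i) δ)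
      (Metric.closedBall (T • stdVec 0) C) := fun x hx => by simpa using hBC x hx
  have hPL : LipschitzOnWith κ (fun z => a i + M • kernel (1 / α) z)
      (Metric.closedBall (T • stdVec 0) C) :=
    lipschitzOnWith_of_hasFDerivAt (convex_closedBall _ _)
      (fun z hz => ((hasFDerivAt_kernel (1 / α) (hfar z hz).1).const_smul M).const_add _)
      (fun z hz => by
        rw [norm_smul, Real.norm_eq_abs]
        exact (hfar z hz).2.2.le)
  have hBL : LipschitzOnWith L (fun x => T • stdVec 0 - B x) (Metric.closedBall (a i) δ) :=
    LipschitzOnWith.of_dist_le_mul fun x hx y hy => by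
      rw [dist_sub_left]
      exact (hL.mono hsub).dist_le_mul x hx y hy
  have hfix := existsUnique_fixedPoint_closedBall hδ.le (K := κ * L)
    (by
      rw [hκ, mul_comm, ← div_eq_mul_inv, div_lt_one (by positivity)]
      rw [← NNReal.coe_lt_coe]
      push_cast
      linarith [L.coe_nonneg])
    (fun x hx => by simpa using (hfar _ (hz hx)).2.1.le) (hPL.comp hBL hz)
  refine (existsUnique_congr fun x => ?_).1 hfix
  have hmem : x ∈ Metric.closedBall (a i) δ ↔ ‖x - a i‖ ≤ δ := mem_closedBall_iff_norm
  rw [hmem, and_assoc, and_comm (a := x ≠ a i), and_assoc]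
  refine and_congr_right fun hx => ?_
  have hzx := (hfar _ (hz (hmem.2 hx))).1
  have hforce : force α m a x = T • stdVec 0 ↔ T • stdVec 0 - B x = -m i • kernel α (x - a i) := by
    rw [force_eq_sub i, neg_smul]
    change B x - _ = _ ↔ _
    constructor <;> intro h
    · rw [← h]
      abel
    · rw [sub_eq_iff_eq_add] at h
      rw [h]
      abel
  have hfixx : ((fun z => a i + M • kernel (1 / α) z) ∘ fun x => T • stdVec 0 - B x) x = x ↔
      x - a i = M • kernel (1 / α) (T • stdVec 0 - B x) := by
    rw [sub_eq_iff_eq_add', eq_comm]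
    rfl
  rw [hforce, hfixx]
  constructor
  · intro h
    have hne : x - a i ≠ 0 := by
      rw [h]
      exact smul_ne_zero (neg_ne_zero.2 (Real.rpow_pos_of_pos (hm i) _).ne')
        (kernel_ne_zero _ hzx)
    exact ⟨(eq_neg_smul_kernel_iff hα0 (hm i) hne hzx).2 h, sub_ne_zero.1 hne⟩
  · rintro ⟨h, hne⟩
    exact (eq_neg_smul_kernel_iff hα0 (hm i) (sub_ne_zero.2 hne) hzx).1 h

theorem eventually_det_forceDeriv_pos_cobounded (hα : 1 ≤ α) :
    ∀ᶠ x in cobounded Plane, 0 < (forceDeriv α m a x).det := by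
  have h1 : Tendsto (fun x => (forceDeriv α m a x).det) (cobounded Plane)
      (𝓝 (ContinuousLinearMap.id ℝ Plane - 0).det) :=
    (ContinuousLinearMap.continuous_det.tendsto _).comp
      (tendsto_const_nhds.sub (tendsto_attractionDeriv_cobounded hα _))
  refine h1.eventually (lt_mem_nhds ?_)
  rw [sub_zero, det_eq_stdVec]
  simp

/-- Across `x - a i` the singular term contributes `-m i * ‖x - a i‖ ^ (-(α + 1))`, which outweighs
the bounded remainder. A negative direction and a positive trace force a negative determinant. -/
theorem eventually_det_forceDeriv_neg_nhdsNE (hα : 1 ≤ α) (hm : ∀ j, 0 < m j)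
    (ha : Function.Injective a) (i : Fin n) :
    ∀ᶠ x in 𝓝[≠] a i, (forceDeriv α m a x).det < 0 := by
  set D : Plane → Plane →L[ℝ] Plane := fun x =>
    ContinuousLinearMap.id ℝ Plane - attractionDeriv α m a (Finset.univ.erase i) x with hD
  have hDc : ContinuousAt D (a i) := continuousAt_const.sub
    (continuousAt_attractionDeriv fun j hj => sub_ne_zero_of_mem_erase ha hj)
  have h1 : ∀ᶠ x in 𝓝[≠] a i, ‖D x‖ < ‖D (a i)‖ + 1 :=
    nhdsWithin_le_nhds (hDc.norm.eventually (gt_mem_nhds (lt_add_one _)))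
  have h2 : ∀ᶠ x in 𝓝[≠] a i, ‖D (a i)‖ + 1 < m i * ‖x - a i‖ ^ (-(α + 1)) :=
    (((tendsto_norm_rpow_neg_nhdsNE (show 0 < α + 1 by linarith)).comp
      (tendsto_sub_nhdsNE (a i))).const_mul_atTop (hm i)).eventually_gt_atTop _
  have h3 : ∀ᶠ x in 𝓝[≠] a i, x ∈ freeRegion a := by
    have : ∀ᶠ x in 𝓝[≠] a i, ∀ j, x - a j ≠ 0 := eventually_all.2 fun j => by
      by_cases hj : j = i
      · subst hj
        filter_upwards [self_mem_nhdsWithin] with x hx using sub_ne_zero.2 hx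
      · exact nhdsWithin_le_nhds ((continuousAt_id.sub continuousAt_const).eventually_ne
          (sub_ne_zero.2 (ha.ne (Ne.symm hj))))
    filter_upwards [this] with x hx using mem_freeRegion.2 hx
  filter_upwards [h1, h2, h3] with x hx1 hx2 hx
  set u := x - a i with hu
  have hu0 : u ≠ 0 := mem_freeRegion.1 hx i
  set v : Plane := !₂[-u 1, u 0] with hv
  have hvu : ‖v‖ = ‖u‖ := by
    rw [EuclideanSpace.norm_eq, EuclideanSpace.norm_eq]
    simp [hv, Fin.sum_univ_two, add_comm]
  have huv : ⟪u, v⟫ = 0 := by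
    simp [hv, PiLp.inner_apply, Fin.sum_univ_two]
    ring
  refine det_neg_of_inner_neg (forceDeriv_symm x) (trace_forceDeriv_pos hα hm hx) (v := v) ?_
  have h4 : forceDeriv α m a x v = D x v - m i • kernelDeriv α u v := by
    rw [forceDeriv, attractionDeriv, ← Finset.sum_erase_add _ _ (Finset.mem_univ i), ← sub_sub]
    rfl
  rw [h4, inner_sub_left, inner_smul_left, inner_kernelDeriv_of_inner_eq_zero α huv]
  have h5 : ⟪D x v, v⟫ ≤ ‖D x‖ * ‖v‖ * ‖v‖ :=
    (real_inner_le_norm _ _).trans (by gcongr; exact (D x).le_opNorm v)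
  have h6 : 0 < ‖v‖ ^ 2 := by rw [hvu]; have := norm_pos_iff.2 hu0; positivity
  simp only [RCLike.conj_to_real]
  nlinarith

theorem exists_pairwiseDisjoint_closedBall (ha : Function.Injective a) :
    ∃ δ₀ > 0, ∀ δ ≤ δ₀, ∀ i j, i ≠ j → ∀ x, ‖x - a i‖ ≤ δ → ¬ ‖x - a j‖ ≤ δ := by
  have h1 : ∀ᶠ δ in 𝓝[>] (0 : ℝ), ∀ i j, i ≠ j → δ + δ < ‖a i - a j‖ :=
    eventually_all.2 fun i => eventually_all.2 fun j => by
      by_cases hij : i = j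
      · simp [hij]
      · have h2 : 0 < ‖a i - a j‖ := norm_sub_pos_iff.2 (ha.ne hij)
        filter_upwards [nhdsWithin_le_nhds (gt_mem_nhds (half_pos h2))] with δ hδ _
        linarith
  obtain ⟨δ₀, hδ₀, hpos⟩ := (h1.and self_mem_nhdsWithin).exists
  refine ⟨δ₀, hpos, fun δ hδ i j hij x hi hj => ?_⟩
  have h3 := norm_sub_le_norm_sub_add_norm_sub (a i) x (a j)
  rw [norm_sub_rev (a i) x] at h3
  linarith [hδ₀ i j hij]

/-- The force takes some large value at exactly `n + 1` points: one far away, with positive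
Jacobian determinant, and one near each primary, with negative Jacobian determinant. -/
theorem exists_force_fiber (hα : 1 ≤ α) (hm : ∀ j, 0 < m j) (ha : Function.Injective a) :
    ∃ T > (0 : ℝ), ∃ S : Finset Plane,
      (∀ x, x ∈ S ↔ x ∈ freeRegion a ∧ force α m a x = T • stdVec 0) ∧
      (∀ x ∈ S, (forceDeriv α m a x).det ≠ 0) ∧
      ∑ x ∈ S, (SignType.sign (forceDeriv α m a x).det : ℝ) = 1 - n := by
  obtain ⟨R₁, hR₁⟩ := exists_forall_existsUnique_force_cobounded (m := m) (a := a) hα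
  have hU : ∀ᶠ x in cobounded Plane, ∀ j, x - a j ≠ 0 := eventually_all.2 fun j => by
    filter_upwards [eventually_ne_cobounded (a j)] with x hx using sub_ne_zero.2 hx
  obtain ⟨R₂, -, hR₂⟩ := (hasBasis_cobounded_norm.eventually_iff).1
    (hU.and (eventually_det_forceDeriv_pos_cobounded (m := m) (a := a) hα))
  set R := max R₁ R₂
  obtain ⟨δ₁, hδ₁, hdisj⟩ := exists_pairwiseDisjoint_closedBall ha
  have h1 : ∀ᶠ δ in 𝓝[>] (0 : ℝ), ∀ i, (∀ x, x ≠ a i → ‖x - a i‖ ≤ δ →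
      (forceDeriv α m a x).det < 0) ∧ ∀ᶠ T : ℝ in atTop, ∃! x : Plane,
        (x ≠ a i ∧ ‖x - a i‖ ≤ δ) ∧ force α m a x = T • stdVec 0 := by
    refine eventually_all.2 fun i => ?_
    obtain ⟨δ₂, hδ₂, H⟩ := exists_forall_existsUnique_force_nhdsNE hα hm ha i
    obtain ⟨δ₃, hδ₃, H'⟩ := Metric.eventually_nhds_iff.1
      (eventually_nhdsWithin_iff.1 (eventually_det_forceDeriv_neg_nhdsNE hα hm ha i))
    filter_upwards [nhdsWithin_le_nhds (gt_mem_nhds hδ₂), nhdsWithin_le_nhds (gt_mem_nhds hδ₃),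
      self_mem_nhdsWithin] with δ h2 h3 h0
    exact ⟨fun x hx hxδ => H' (by rw [dist_eq_norm]; linarith) hx, H δ h0 h2.le⟩
  obtain ⟨δ, ⟨hδ, hδδ₁⟩, hδ0⟩ := ((h1.and (nhdsWithin_le_nhds (gt_mem_nhds hδ₁))).and
    self_mem_nhdsWithin).exists
  have hδ0 : 0 < δ := hδ0
  replace hdisj := hdisj δ hδδ₁.le
  -- Between the far region and the small balls the force is bounded by some `C`, so a value with `T
  -- > C` is not taken there.
  have hK : IsCompact (Metric.closedBall 0 R \ ⋃ i, Metric.ball (a i) δ) :=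
    (isCompact_closedBall 0 R).diff (isOpen_iUnion fun i => Metric.isOpen_ball)
  have hKU : Metric.closedBall 0 R \ ⋃ i, Metric.ball (a i) δ ⊆ freeRegion a := by
    rintro x ⟨-, hx⟩ ⟨i, rfl⟩
    exact hx (mem_iUnion.2 ⟨i, Metric.mem_ball_self hδ0⟩)
  obtain ⟨C, hC⟩ := hK.exists_bound_of_continuousOn
    ((contDiffOn_force (α := α) (m := m)).continuousOn.mono hKU)
  obtain ⟨T, ⟨hTi, hT⟩, hTC, hT0⟩ := (((eventually_all.2 fun i => (hδ i).2).and
    (hR₁ R (le_max_left _ _))).and ((eventually_gt_atTop C).and (eventually_gt_atTop 0))).exists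
  obtain ⟨y, ⟨hyR, hyF⟩, hyu⟩ := hT
  choose p hp hpu using hTi
  have hpU : ∀ i x, x ≠ a i → ‖x - a i‖ ≤ δ → x ∈ freeRegion a := fun i x hx hxδ => by
    rintro ⟨j, rfl⟩
    have hij : i ≠ j := fun h => hx (by rw [h])
    exact hdisj i j hij (a j) hxδ (by simpa using hδ0.le)
  have hyd : 0 < (forceDeriv α m a y).det := (hR₂ ((le_max_right R₁ R₂).trans hyR.le)).2
  have hyU : y ∈ freeRegion a := mem_freeRegion.2 (hR₂ ((le_max_right R₁ R₂).trans hyR.le)).1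
  have hpd : ∀ i, (forceDeriv α m a (p i)).det < 0 := fun i =>
    (hδ i).1 _ (hp i).1.1 (hp i).1.2
  have hpinj : Function.Injective p := fun i j hij => by
    by_contra h
    exact hdisj i j h (p i) (hp i).1.2 (hij ▸ (hp j).1.2)
  -- The far point is distinct from the near ones because the determinants have opposite signs.
  have hyp : y ∉ Finset.univ.map ⟨p, hpinj⟩ := by
    simp only [Finset.mem_map, Finset.mem_univ, true_and, Function.Embedding.coeFn_mk, not_exists]
    rintro i rfl
    exact (hpd i).not_gt hyd
  refine ⟨T, hT0, Finset.cons y (Finset.univ.map ⟨p, hpinj⟩) hyp, fun x => ?_, ?_, ?_⟩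
  · simp only [Finset.mem_cons, Finset.mem_map, Finset.mem_univ, true_and,
      Function.Embedding.coeFn_mk]
    constructor
    · rintro (rfl | ⟨i, rfl⟩)
      · exact ⟨hyU, hyF⟩
      · exact ⟨hpU i _ (hp i).1.1 (hp i).1.2, (hp i).2⟩
    · rintro ⟨hxU, hxF⟩
      by_cases hxR : R < ‖x‖
      · exact Or.inl (hyu x ⟨hxR, hxF⟩)
      · by_cases hxi : ∃ i, ‖x - a i‖ < δ
        · obtain ⟨i, hi⟩ := hxi
          exact Or.inr ⟨i, (hpu i x ⟨⟨sub_ne_zero.1 (mem_freeRegion.1 hxU i), hi.le⟩, hxF⟩).symm⟩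
        · exfalso
          have := hC x ⟨by simpa using hxR, by
            simpa [dist_eq_norm] using hxi⟩
          rw [hxF, norm_smul, Real.norm_of_nonneg hT0.le] at this
          simp at this
          linarith
  · intro x hx
    simp only [Finset.mem_cons, Finset.mem_map, Finset.mem_univ, true_and,
      Function.Embedding.coeFn_mk] at hx
    rcases hx with rfl | ⟨i, rfl⟩
    · exact hyd.ne'
    · exact (hpd i).ne
  · rw [Finset.sum_cons, Finset.sum_map]
    simp [sign_pos hyd, sign_neg (hpd _), sub_eq_add_neg]

/-! ### Critical points and the Morse count -/

theorem isCriticalPoint_iff {x : Plane} (hx : x ∈ freeRegion a) :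
    IsCriticalPoint (potential α m a) x ↔ force α m a x = 0 := by
  have h := hasFDerivAt_potential (α := α) (m := m) hx
  constructor
  · intro hc
    have := h.unique hc
    simpa using congrArg (fun L => L (force α m a x)) this
  · intro h0
    rw [h0, map_zero] at h
    exact h

theorem eventually_hasFDerivAt_potential {x : Plane} (hx : x ∈ freeRegion a) :
    ∀ᶠ z in 𝓝 x, HasFDerivAt (potential α m a) (innerSL ℝ (force α m a z)) z := by
  filter_upwards [(isOpen_freeRegion a).mem_nhds hx] with z hz using hasFDerivAt_potential hz

theorem fderiv_fderiv_potential (hs : ContDiffOn ℝ ∞ (potential α m a) (freeRegion a))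
    {x : Plane} (hx : x ∈ freeRegion a) (u v : Plane) :
    fderiv ℝ (fderiv ℝ (potential α m a)) x u v = ⟪forceDeriv α m a x u, v⟫ := by
  have h1 : DifferentiableAt ℝ (fderiv ℝ (potential α m a)) x :=
    ((hs.contDiffAt ((isOpen_freeRegion a).mem_nhds hx)).fderiv_right (m := 1)
      (by norm_cast)).differentiableAt one_ne_zero
  have h2 := (h1.hasFDerivAt.clm_apply (hasFDerivAt_const v x)).fderiv
  have h3 : (fun z => fderiv ℝ (potential α m a) z v) =ᶠ[𝓝 x] fun z => ⟪force α m a z, v⟫ := by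
    filter_upwards [eventually_hasFDerivAt_potential hx] with z hz
    rw [hz.fderiv, innerSL_apply_apply]
  have h4 := ((hasFDerivAt_force (α := α) (m := m) hx).inner ℝ (hasFDerivAt_const v x)).fderiv
  rw [h3.fderiv_eq, h4] at h2
  have := congrArg (fun L => L u) h2
  simpa using this.symm

theorem det_forceDeriv_ne_zero (hV : IsMorseOn (potential α m a) (freeRegion a)) {x : Plane}
    (hx : x ∈ freeRegion a) (h0 : force α m a x = 0) : (forceDeriv α m a x).det ≠ 0 := by
  intro hdet
  obtain ⟨u, hu, hu0⟩ := (Submodule.ne_bot_iff _).1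
    (LinearMap.bot_lt_ker_of_det_eq_zero (f := (forceDeriv α m a x : Plane →ₗ[ℝ] Plane)) hdet).ne'
  refine hu0 (hV.2 x hx ((isCriticalPoint_iff hx).2 h0) u fun v => ?_)
  rw [fderiv_fderiv_potential hV.1 hx, show forceDeriv α m a x u = 0 from hu, inner_zero_left]

/-- A positive trace makes some diagonal entry of the Hessian positive, so the potential is strictly
convex to second order in a coordinate direction. -/
theorem not_isLocalMax_potential (hα : 1 ≤ α) (hm : ∀ j, 0 < m j) {x : Plane}
    (hx : x ∈ freeRegion a) : ¬ IsLocalMax (potential α m a) x := by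
  have htr := trace_forceDeriv_pos hα hm hx
  obtain ⟨v, hv⟩ : ∃ v, 0 < ⟪forceDeriv α m a x v, v⟫ := by
    by_cases h : 0 < forceDeriv α m a x (stdVec 0) 0
    · exact ⟨stdVec 0, by simpa [EuclideanSpace.inner_single_right] using h⟩
    · refine ⟨stdVec 1, ?_⟩
      have : 0 < forceDeriv α m a x (stdVec 1) 1 := by linarith
      simpa [EuclideanSpace.inner_single_right] using this
  exact not_isLocalMax_of_inner_pos (eventually_hasFDerivAt_potential hx) (hasFDerivAt_force hx) hv

theorem force_eq_zero_of_isLocalMin {x : Plane} (hx : x ∈ freeRegion a)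
    (h : IsLocalMin (potential α m a) x) : force α m a x = 0 := by
  have h1 := hasFDerivAt_potential (α := α) (m := m) hx
  have h2 := h.hasFDerivAt_eq_zero h1
  rw [h2] at h1
  exact (isCriticalPoint_iff hx).1 h1

theorem isLocalMin_potential_iff (hα : 1 ≤ α) (hm : ∀ j, 0 < m j)
    (hV : IsMorseOn (potential α m a) (freeRegion a)) {x : Plane} (hx : x ∈ freeRegion a)
    (h0 : force α m a x = 0) :
    IsLocalMin (potential α m a) x ↔ 0 < (forceDeriv α m a x).det := by
  have hf := eventually_hasFDerivAt_potential (α := α) (m := m) hx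
  have hF := hasFDerivAt_force (α := α) (m := m) hx
  have htr := trace_forceDeriv_pos hα hm hx
  constructor
  · intro hmin
    refine lt_of_le_of_ne (not_lt.1 fun hneg => ?_) (det_forceDeriv_ne_zero hV hx h0).symm
    obtain ⟨v, hv⟩ := exists_inner_neg_of_det_neg (forceDeriv_symm x) htr hneg
    exact not_isLocalMin_of_inner_neg hf hF hv hmin
  · intro hpos
    obtain ⟨c, hc, hA⟩ := exists_coercive_of_det_pos (forceDeriv_symm x) htr hpos
    exact isLocalMin_of_coercive hf hF h0 hc hA

/-- Properness confines the zeros to a compact subset of the free region. An accumulation point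
would be a zero with invertible derivative, and such a zero is isolated. -/
theorem finite_zeros_force (hα : 1 ≤ α) (hm : ∀ j, 0 < m j) (ha : Function.Injective a)
    (hV : IsMorseOn (potential α m a) (freeRegion a)) :
    {x | x ∈ freeRegion a ∧ force α m a x = 0}.Finite := by
  obtain ⟨K, hK, hKU, hKF⟩ := isProperOn_force hα hm ha 0
  have hsub : {x | x ∈ freeRegion a ∧ force α m a x = 0} ⊆ K := fun x hx => by
    by_contra h
    have := hKF x ⟨hx.1, h⟩
    simp [hx.2] at this
  by_contra hinf
  obtain ⟨x, hxK, hacc⟩ := Set.Infinite.exists_accPt_of_subset_isCompact hinf hK hsub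
  have hxU := hKU hxK
  have hx0 : force α m a x = 0 := by
    have h1 : Tendsto (force α m a) (𝓝[≠] x) (𝓝 (force α m a x)) :=
      (hasFDerivAt_force hxU).continuousAt.tendsto.mono_left nhdsWithin_le_nhds
    have h2 : ∃ᶠ z in 𝓝[≠] x, force α m a z = 0 :=
      (accPt_iff_frequently_nhdsNE.1 hacc).mono fun z hz => hz.2
    by_contra hne
    exact h2 (h1.eventually_ne hne)
  have hne : ∀ᶠ z in 𝓝[≠] x, force α m a z ≠ 0 := by
    have hd := det_forceDeriv_ne_zero hV hxU hx0
    set A := (forceDeriv α m a x).toContinuousLinearEquivOfDetNeZero hd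
    exact (hasFDerivAt_force (α := α) (m := m) hxU).eventually_ne
      ⟨_, A.antilipschitz⟩
  exact (accPt_iff_frequently_nhdsNE.1 hacc) (hne.mono fun z hz h => hz h.2)

/-- The Morse count: minima minus saddles is the Euler characteristic `1 - n`. -/
theorem ncard_saddlePoints (hα : 1 ≤ α) (hm : ∀ j, 0 < m j) (ha : Function.Injective a)
    (hV : IsMorseOn (potential α m a) (freeRegion a)) :
    (minimumPoints (potential α m a) (freeRegion a)).Finite ∧
    (saddlePoints (potential α m a) (freeRegion a)).Finite ∧
    ((saddlePoints (potential α m a) (freeRegion a)).ncard : ℤ) =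
      (n : ℤ) - 1 + ((minimumPoints (potential α m a) (freeRegion a)).ncard : ℤ) := by
  have hfin := finite_zeros_force hα hm ha hV
  set S₀ := hfin.toFinset with hS₀
  have hmem : ∀ x, x ∈ S₀ ↔ x ∈ freeRegion a ∧ force α m a x = 0 := fun x => by simp [hS₀]
  have hfd : ∀ x ∈ freeRegion a, fderiv ℝ (force α m a) x = forceDeriv α m a x := fun x hx =>
    (hasFDerivAt_force hx).fderiv
  have hmin : minimumPoints (potential α m a) (freeRegion a) =
      (S₀.filter fun x => 0 < (forceDeriv α m a x).det : Finset Plane) := by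
    ext x
    simp only [minimumPoints, mem_ofPred_eq, Finset.coe_filter, hmem]
    constructor
    · rintro ⟨hx, h⟩
      have h0 := force_eq_zero_of_isLocalMin hx h
      exact ⟨⟨hx, h0⟩, (isLocalMin_potential_iff hα hm hV hx h0).1 h⟩
    · rintro ⟨⟨hx, h0⟩, h⟩
      exact ⟨hx, (isLocalMin_potential_iff hα hm hV hx h0).2 h⟩
  have hsad : saddlePoints (potential α m a) (freeRegion a) =
      (S₀.filter fun x => ¬ 0 < (forceDeriv α m a x).det : Finset Plane) := by
    ext x
    simp only [saddlePoints, mem_ofPred_eq, Finset.coe_filter, hmem]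
    constructor
    · rintro ⟨hx, hc, h, -⟩
      have h0 := (isCriticalPoint_iff hx).1 hc
      exact ⟨⟨hx, h0⟩, fun h' => h ((isLocalMin_potential_iff hα hm hV hx h0).2 h')⟩
    · rintro ⟨⟨hx, h0⟩, h⟩
      exact ⟨hx, (isCriticalPoint_iff hx).2 h0,
        fun h' => h ((isLocalMin_potential_iff hα hm hV hx h0).1 h'),
        not_isLocalMax_potential hα hm hx⟩
  refine ⟨hmin ▸ Finset.finite_toSet _, hsad ▸ Finset.finite_toSet _, ?_⟩
  rw [hmin, hsad, ncard_coe_finset, ncard_coe_finset]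
  obtain ⟨T, hT, S₁, hS₁, hdet₁, hsum₁⟩ := exists_force_fiber hα hm ha
  have hdet₀ : ∀ x ∈ S₀, (forceDeriv α m a x).det ≠ 0 := fun x hx =>
    det_forceDeriv_ne_zero hV ((hmem x).1 hx).1 ((hmem x).1 hx).2
  -- Over `0` the signed sum is minima minus saddles; over the far value it is `1 - n`.
  have key := sum_sign_det_eq (T := T) (isOpen_freeRegion a) (contDiffOn_force.of_le (by norm_cast))
    (isProperOn_force hα hm ha) hT hmem
    (fun x hx => by rw [hfd x ((hmem x).1 hx).1]; exact hdet₀ x hx) hS₁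
    (fun x hx => by rw [hfd x ((hS₁ x).1 hx).1]; exact hdet₁ x hx)
  rw [Finset.sum_congr rfl fun x hx => by rw [hfd x ((hmem x).1 hx).1],
    Finset.sum_congr (s₁ := S₁) rfl fun x hx => by rw [hfd x ((hS₁ x).1 hx).1], hsum₁,
    ← Finset.sum_filter_add_sum_filter_not S₀ fun x => 0 < (forceDeriv α m a x).det,
    Finset.sum_congr (g := fun _ => (1 : ℝ)) rfl fun x hx => by
      rw [sign_pos (Finset.mem_filter.1 hx).2]; simp,
    Finset.sum_congr (s₁ := S₀.filter fun x => ¬ 0 < (forceDeriv α m a x).det)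
      (g := fun _ => (-1 : ℝ)) rfl fun x hx => by
        rw [sign_neg (lt_of_le_of_ne (not_lt.1 (Finset.mem_filter.1 hx).2)
          (hdet₀ x (Finset.mem_filter.1 hx).1))]; simp] at key
  simp only [Finset.sum_const, nsmul_eq_mul, mul_one, mul_neg] at key
  have key' : ((S₀.filter fun x => ¬ 0 < (forceDeriv α m a x).det).card : ℝ) =
      n - 1 + (S₀.filter fun x => 0 < (forceDeriv α m a x).det).card := by linarith
  exact_mod_cast key'

end Satellite

theorem mainTheorem9 (α : ℝ) (hα : 1 ≤ α) (n : ℕ) (m : Fin n → ℝ) (hm : ∀ j, 0 < m j)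
    (a : Fin n → Satellite.Plane) (ha : Function.Injective a)
    (hrel : Satellite.IsRelativeEquilibrium α m a) :
    (∀ x ∈ Satellite.freeRegion a, ¬ IsLocalMax (Satellite.potential α m a) x) ∧
    (∃ x ∈ Satellite.freeRegion a, ∀ y ∈ Satellite.freeRegion a,
      Satellite.potential α m a x ≤ Satellite.potential α m a y) ∧
    (Satellite.IsMorseOn (Satellite.potential α m a) (Satellite.freeRegion a) →
      (Satellite.minimumPoints (Satellite.potential α m a) (Satellite.freeRegion a)).Finite ∧
      (Satellite.saddlePoints (Satellite.potential α m a) (Satellite.freeRegion a)).Finite ∧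
      ((Satellite.saddlePoints (Satellite.potential α m a) (Satellite.freeRegion a)).ncard : ℤ) =
        (n : ℤ) - 1 +
          ((Satellite.minimumPoints (Satellite.potential α m a)
            (Satellite.freeRegion a)).ncard : ℤ) ∧
      n ≤ (Satellite.saddlePoints (Satellite.potential α m a)
        (Satellite.freeRegion a)).ncard) := by
  refine ⟨fun x hx => Satellite.not_isLocalMax_potential hα hm hx,
    Satellite.exists_forall_potential_le hα hm ha, fun hV => ?_⟩
  obtain ⟨hmin, hsad, hcount⟩ := Satellite.ncard_saddlePoints hα hm ha hV
  refine ⟨hmin, hsad, hcount, ?_⟩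
  -- The global minimum point makes the number of minima at least `1`, which turns `n - 1 + #minima`
  -- into a bound by `n`.
  obtain ⟨x, hx, hxmin⟩ := Satellite.exists_forall_potential_le hα hm ha
  have hpos : 0 < (Satellite.minimumPoints (Satellite.potential α m a)
      (Satellite.freeRegion a)).ncard := by
    refine (Set.ncard_pos hmin).2 ⟨x, hx, ?_⟩
    filter_upwards [(Satellite.isOpen_freeRegion a).mem_nhds hx] with y hy using hxmin y hy
  omega
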